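/- **Model.** There are $m\ge 1$ resources. A request is a triple $\gamma=(f,b,\mathcal X)$ with a compact action set $\mathcal X\subset\mathbb R_+^d$ containing $0$, a reward function $f:\mathcal X\to\mathbb R_+$ and a consumption function $b:\mathcal X\to\mathbb R_+^m$ with $b(0)=0$. Let $\mathcal S$ be a set of requests and $\bar f,\bar b$ constants with $f(x)\le\bar f$ and $\|b(x)\|_\infty\le\bar b$ for all $(f,b,\mathcal X)\in\mathcal S$, $x\in\mathcal X$. Requests $\vec\gamma=(\gamma_1,\dots,\gamma_T)$, $\gamma_t=(f_t,b_t,\mathcal X_t)$, are drawn i.i.d. from a probability distribution $\mathcal P$ on $\mathcal S$. The budget $B\in\mathbb R_{++}^m$ satisfies $B_i\ge 2\bar b$ for all $i$; put $\rho_T=B/T$ and $\underline\rho_T=\min_j\rho_{T,j}$. Let $\mathrm{OPT}(T,\vec\gamma)$ be the supremum of $\sum_{t\le T}f_t(x_t)$ over $x\in\prod_t\mathcal X_t$ with $\sum_{t\le T}b_t(x_t)\le B$. Fix integers $1\le\tau_1\le\tau_2$ and a target consumption sequence $\vec\lambda=(\lambda_1,\dots,\lambda_{\tau_2})$, $\lambda_t\in\mathbb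 R_+^m$, $\sum_{t\le\tau_2}\lambda_t\le B$, and let $\bar\lambda$ satisfy $\|\lambda_t\|_\infty\le\bar\lambda$ for all $t\le\tau_2$. **Algorithm (variable target dual mirror descent).** Let $h:\mathbb R^m\to\mathbb R$ be a reference function that is continuous on $\mathbb R^m_+$, differentiable or essentially smooth on $\mathbb R^m_+$ (that is, differentiable on $\mathbb R^m_{++}$, and $\|\nabla h(\mu)\|\to\infty$ as $\mu\in\mathbb R^m_{++}$ tends to a point of $\mathbb R_+^m$, if any, at which $h$ is not differentiable), and $\sigma$-strongly convex on $\mathbb R_+^m$ in the $\ell_1$-norm: for some $\sigma>0$, $h(\mu)\ge h(\nu)+\nabla h(\nu)^\top(\mu-\nu)+\frac\sigma2\|\mu-\nu\|_1^2$ for all $\mu,\nu\in\mathbb R^m_+$ with $h$ differentiable at $\nu$. Let $V_h(x,y)=h(x)-h(y)-\nabla h(y)^\top(x-y)$. Given a step size $\eta$, an initial dual $\mu_1\in\mathbb R_+^m$ at which $h$ is differentiable, and $B_1=B$, at each time $t$ the algorithm observes $\gamma_t$; picks $\tilde x_t\in\arg\max_{x\in\mathcal X_t}\{f_t(x)-\mu_t^\top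 b_t(x)\}$ (the maxima are assumed to be attained, and ties to be broken measurably and non-anticipatingly); plays $x_t=\tilde x_t$ if $b_t(\tilde x_t)\le B_t$ and $x_t=0$ otherwise; sets $B_{t+1}=B_t-b_t(x_t)$; and updates $$\mu_{t+1}=\arg\min_{\mu\in\mathbb R_+^m}\Big\{(\lambda_t-b_t(\tilde x_t))^\top\mu+\tfrac1\eta V_h(\mu,\mu_t)\Big\}.$$ Its reward is $R(A|T,\vec\gamma)=\sum_{t\le T}f_t(x_t)$ and its performance ratio is $c(A|T,\mathcal P)=\mathbb E_{\vec\gamma\sim\mathcal P^T}[R(A|T,\vec\gamma)]/\mathbb E_{\vec\gamma\sim\mathcal P^T}[\mathrm{OPT}(T,\vec\gamma)]$. **Constants.** Let $$c(\vec\lambda,T)=\frac1T\sum_{t=1}^T\min\Big\{\min_{1\le j\le m}\frac{\lambda_{t,j}}{\rho_{T,j}},1\Big\},\quad C_1^{(T)}=\frac{\bar f\,\bar b}{\underline\rho_T},\quad C_2=\frac{(\bar b+\bar\lambda)^2}{2\sigma},$$ $$C_3^{(T)}=\max\{V_h(\mu,\mu_1):\mu\in\{0,(\bar f/\underline\rho_T)e_1,\dots,(\bar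 f/\underline\rho_T)e_m\}\},$$ and let $C_1',C_3'$ be any constants with $C_1^{(T)}\le C_1'$ and $C_3^{(T)}\le C_3'$ for all integers $T\in[\tau_1,\tau_2]$ (for instance the maxima over the window). **Proposition.** Assume that for some $\kappa>0$, $\mathbb E_{\vec\gamma\sim\mathcal P^T}[\mathrm{OPT}(T,\vec\gamma)]\ge\kappa T$ for all integers $T\in[\tau_1,\tau_2]$. Then the algorithm with step size $\eta=\sqrt{C_3'/(C_2\tau_2)}$ satisfies, for every integer $T\in[\tau_1,\tau_2]$, $$c(A|T,\mathcal P)\ \ge\ c(\vec\lambda,T)-\epsilon,\qquad \epsilon=\frac{C_1'}{\kappa\tau_1}+\frac{2\sqrt{(\tau_2/\tau_1)\,C_2C_3'}}{\kappa\sqrt{\tau_1}}.$$ Moreover, $\epsilon\to0$ as $\tau_1\to\infty$ with $\tau_2/\tau_1$ fixed, whenever the nonnegative constants $C_1',C_2,C_3'$ stay bounded and $\kappa$ stays bounded away from $0$ (in particular when they are fixed). -/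

import Mathlib

open MeasureTheory Filter Topology

noncomputable section

/-- A request `(f, b, 𝒳)` with `m` resources: a compact action set `𝒳 ⊆ ℝ₊ᵈ` containing `0`,
a reward function `f : 𝒳 → ℝ₊` and a consumption function `b : 𝒳 → ℝ₊ᵐ` with `b 0 = 0`. -/
structure Request (d m : ℕ) where
  action : Set (Fin d → ℝ)
  isCompact_action : IsCompact action
  action_nonneg : ∀ x ∈ action, 0 ≤ x
  zero_mem : (0 : Fin d → ℝ) ∈ action
  reward : action → ℝ
  reward_nonneg : ∀ x, 0 ≤ reward x
  consumption : action → Fin m → ℝ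
  consumption_nonneg : ∀ x, 0 ≤ consumption x
  consumption_zero : consumption ⟨0, zero_mem⟩ = 0

/-- The action `0`, which is available for every request and consumes nothing. -/
def Request.null {d m : ℕ} (q : Request d m) : q.action := ⟨0, q.zero_mem⟩

/-- The hindsight-optimal reward `OPT(T, γ)`: the optimal value of
`max ∑ₜ fₜ(xₜ)` subject to `xₜ ∈ 𝒳ₜ` and `∑ₜ bₜ(xₜ) ≤ B`. -/
def hindsightOpt {d m : ℕ} {S : Set (Request d m)} (B : Fin m → ℝ) (T : ℕ)
    (γ : Fin T → S) : ℝ :=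
  sSup {r : ℝ | ∃ x : (t : Fin T) → (γ t : Request d m).action,
    (∑ t, (γ t : Request d m).consumption (x t) ≤ B) ∧
      r = ∑ t, (γ t : Request d m).reward (x t)}

/-- The Bregman divergence `V_h(x, y) = h(x) - h(y) - ∇h(y)ᵀ(x - y)`. -/
def bregman {m : ℕ} (h : (Fin m → ℝ) → ℝ) (x y : Fin m → ℝ) : ℝ :=
  h x - h y - fderiv ℝ h y (x - y)

/-- Reference functions of mirror descent on `ℝ₊ᵐ`: continuous on `ℝ₊ᵐ`, differentiable or
essentially smooth there (differentiable in the interior, with a gradient that blows up at the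
boundary points, if any, at which `h` is not differentiable), and `σ`-strongly convex on `ℝ₊ᵐ`
with respect to the `ℓ¹` norm. -/
structure IsReferenceFunction {m : ℕ} (h : (Fin m → ℝ) → ℝ) (σ : ℝ) : Prop where
  continuousOn : ContinuousOn h {μ | 0 ≤ μ}
  differentiableAt_of_pos : ∀ μ : Fin m → ℝ, (∀ j, 0 < μ j) → DifferentiableAt ℝ h μ
  essentiallySmooth : ∀ ν : Fin m → ℝ, 0 ≤ ν → ¬ DifferentiableAt ℝ h ν →
    Tendsto (fun μ => ‖fderiv ℝ h μ‖) (𝓝[{μ | ∀ j, 0 < μ j}] ν) atTop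
  stronglyConvex : ∀ μ ν : Fin m → ℝ, 0 ≤ μ → 0 ≤ ν → DifferentiableAt ℝ h ν →
    h ν + fderiv ℝ h ν (μ - ν) + σ / 2 * (∑ j, |μ j - ν j|) ^ 2 ≤ h μ

/-- `ν` is a minimizer of `gᵀν + V_h(ν, μ) / η` over `ν ∈ ℝ₊ᵐ`. -/
def IsMirrorStep {m : ℕ} (h : (Fin m → ℝ) → ℝ) (η : ℝ) (g μ ν : Fin m → ℝ) : Prop :=
  0 ≤ ν ∧ ∀ ν' : Fin m → ℝ, 0 ≤ ν' →
    g ⬝ᵥ ν + 1 / η * bregman h ν μ ≤ g ⬝ᵥ ν' + 1 / η * bregman h ν' μ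

open Classical in
/-- The mirror descent update `argmin_{ν ∈ ℝ₊ᵐ} gᵀν + V_h(ν, μ) / η` (the value `μ` is used
only if there is no minimizer). -/
def mirrorStep {m : ℕ} (h : (Fin m → ℝ) → ℝ) (η : ℝ) (g μ : Fin m → ℝ) : Fin m → ℝ :=
  if hν : ∃ ν, IsMirrorStep h η g μ ν then hν.choose else μ

/-- The input of variable target dual mirror descent. Time starts at `0`, so that `target t` is
the target consumption of the `(t + 1)`-st request. `rule t past q μ` is the candidate action
`x̃ₜ`, an element of `argmax_{x ∈ 𝒳} f(x) - μᵀb(x)` for the request `q = (f, b, 𝒳)`; ties may be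
broken depending on the time `t` and the requests `past` seen before. -/
structure DMDInput {d m : ℕ} (S : Set (Request d m)) where
  refFun : (Fin m → ℝ) → ℝ
  stepSize : ℝ
  initDual : Fin m → ℝ
  budget : Fin m → ℝ
  target : ℕ → Fin m → ℝ
  rule : (t : ℕ) → (Fin t → S) → (q : S) → (Fin m → ℝ) → (q : Request d m).action

namespace DMDInput

variable {d m : ℕ} {S : Set (Request d m)}

/-- `rule` selects maximizers of `f(x) - μᵀb(x)` over `x ∈ 𝒳`, for all dual variables `μ ≥ 0`. -/
def RuleIsArgmax (A : DMDInput S) : Prop :=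
  ∀ (t : ℕ) (past : Fin t → S) (q : S) (μ : Fin m → ℝ), 0 ≤ μ →
    ∀ x : (q : Request d m).action,
      (q : Request d m).reward x - μ ⬝ᵥ (q : Request d m).consumption x ≤
        (q : Request d m).reward (A.rule t past q μ) -
          μ ⬝ᵥ (q : Request d m).consumption (A.rule t past q μ)

/-- The reward and the consumption of the selected action, and the reward of the action `0`,
depend measurably on the data. -/
def RuleIsMeasurable [MeasurableSpace S] (A : DMDInput S) : Prop :=
  (Measurable fun q : S => (q : Request d m).reward (q : Request d m).null) ∧
  ∀ t : ℕ,
    (Measurable fun p : (Fin t → S) × S × (Fin m → ℝ) =>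
      (p.2.1 : Request d m).reward (A.rule t p.1 p.2.1 p.2.2)) ∧
    (Measurable fun p : (Fin t → S) × S × (Fin m → ℝ) =>
      (p.2.1 : Request d m).consumption (A.rule t p.1 p.2.1 p.2.2))

open Classical in
/-- The action taken: the candidate `x` if its consumption fits into the remaining resources,
and `0` otherwise. -/
def play (q : S) (remaining : Fin m → ℝ) (x : (q : Request d m).action) :
    (q : Request d m).action :=
  if (q : Request d m).consumption x ≤ remaining then x else (q : Request d m).null

/-- The pair (dual variable `μₜ`, remaining resources `Bₜ`) before the request at time `t`. -/
def state (A : DMDInput S) {T : ℕ} (γ : Fin T → S) : ℕ → (Fin m → ℝ) × (Fin m → ℝ)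
  | 0 => (A.initDual, A.budget)
  | t + 1 =>
    if ht : t < T then
      let μ := (state A γ t).1
      let R := (state A γ t).2
      let q : S := γ ⟨t, ht⟩
      let x := A.rule t (fun s => γ (Fin.castLE ht.le s)) q μ
      (mirrorStep A.refFun A.stepSize (A.target t - (q : Request d m).consumption x) μ,
        R - (q : Request d m).consumption (play q R x))
    else state A γ t

/-- The action `xₜ` of the algorithm at time `t`. -/
def act (A : DMDInput S) {T : ℕ} (γ : Fin T → S) (t : Fin T) : (γ t : Request d m).action :=
  play (γ t) (A.state γ t).2
    (A.rule t (fun s => γ (Fin.castLE t.isLt.le s)) (γ t) (A.state γ t).1)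

/-- The total reward `R(A | T, γ) = ∑ₜ fₜ(xₜ)`. -/
def totalReward (A : DMDInput S) (T : ℕ) (γ : Fin T → S) : ℝ :=
  ∑ t, (γ t : Request d m).reward (A.act γ t)

/-- The performance ratio `c(A | T, P) = E[R(A | T, γ)] / E[OPT(T, γ)]`, for `γ ∼ P^T`. -/
def performanceRatio [MeasurableSpace S] (A : DMDInput S) (T : ℕ) (P : Measure S) : ℝ :=
  (∫ γ, A.totalReward T γ ∂(Measure.pi fun _ : Fin T => P)) /
    (∫ γ, hindsightOpt A.budget T γ ∂(Measure.pi fun _ : Fin T => P))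

end DMDInput

/-- A target consumption sequence for budget `B`: nonnegative with `∑_{t < τ₂} λₜ ≤ B`. -/
def IsTargetSequence {m : ℕ} (B : Fin m → ℝ) (τ₂ : ℕ) (lam : ℕ → Fin m → ℝ) : Prop :=
  (∀ t < τ₂, 0 ≤ lam t) ∧ ∑ t ∈ Finset.range τ₂, lam t ≤ B

/-- `c(λ, T) = (1/T) ∑ₜ min {min_j λ_{t,j} / ρ_{T,j}, 1}` with `ρ_T = B / T`. -/
def targetRatio {m : ℕ} (B : Fin m → ℝ) (lam : ℕ → Fin m → ℝ) (T : ℕ) : ℝ :=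
  1 / (T : ℝ) * ∑ t ∈ Finset.range T, min (⨅ j, lam t j / (B j / (T : ℝ))) 1

/-- `min_j ρ_{T,j}`, the smallest per-period endowment. -/
def minRho {m : ℕ} (B : Fin m → ℝ) (T : ℕ) : ℝ := ⨅ j, B j / (T : ℝ)

/-- `C₁^{(T)} = f̄ b̄ / min_j ρ_{T,j}`. -/
def constC1 {m : ℕ} (fbar bbar : ℝ) (B : Fin m → ℝ) (T : ℕ) : ℝ :=
  fbar * bbar / minRho B T

/-- `C₂ = (b̄ + λ̄)² / (2σ)`. -/
def constC2 (bbar lbar σ : ℝ) : ℝ := (bbar + lbar) ^ 2 / (2 * σ)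

/-- `C₃^{(T)}`: the maximum of `V_h(μ, μ₁)` over `μ = 0` and
`μ = (f̄ / min_i ρ_{T,i}) e_j`, `j ∈ [m]`. -/
def constC3 {m : ℕ} (fbar : ℝ) (h : (Fin m → ℝ) → ℝ) (μ₁ B : Fin m → ℝ) (T : ℕ) : ℝ :=
  max (bregman h 0 μ₁) (⨆ j, bregman h (Pi.single j (fbar / minRho B T)) μ₁)

/-- `ε = C₁' / (κ τ₁) + 2 √((τ₂/τ₁) C₂ C₃') / (κ √τ₁)`. -/
def masterError (κ C₁ C₂ C₃ τ₁ τ₂ : ℝ) : ℝ :=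
  C₁ / (κ * τ₁) + 2 * √(τ₂ / τ₁ * C₂ * C₃) / (κ * √τ₁)

end

/-!
The algorithm runs online mirror descent on the Lagrangian dual of the hindsight problem, and the
performance bound adds up two inequalities.

*Mirror descent.* With `gₜ = λₜ - bₜ(x̃ₜ)`, the regret `∑ gₜᵀμₜ - ∑ gₜᵀμ` against any `μ ≥ 0` is at
most `τ₂ C₂ η + V_h(μ, μ₁) / η` (`IsReferenceFunction.sum_dotProduct_le`). This rests on facts
about a single step: the minimizer exists by coercivity (`IsReferenceFunction.exists_forall_le`),
it is a point at which `h` is differentiable by essential smoothness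
(`IsReferenceFunction.differentiableAt_of_forall_le`), so that the next Bregman divergence is
meaningful, and it depends measurably on the data by strong convexity
(`IsReferenceFunction.measurable_mirrorStep`).

*Duality.* Let `n` be the first period before which some resource has less than `b̄` left. Before
`n` the candidate actions are played, and each earns `f*(γₜ, μₜ) + λₜᵀμₜ - gₜᵀμₜ`, where
`f*(γ, μ) = max_x f(x) - μᵀb(x)`. As `f* ≥ 0` and `λₜ ≥ cₜ ρ` for `cₜ = min {min_j λₜⱼ / ρⱼ, 1}`,
weak duality `E[OPT] / T ≤ E[f*(γ, μ)] + ρᵀμ` bounds this below by `cₜ E[OPT] / T - gₜᵀμₜ`, up to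
`cₜ` times the centered term `f*(γₜ, μₜ) - E[f*(γ, μₜ)]`. If `n` is before the end, resource `j` is
nearly used up, and comparing with `μ = (f̄ / min_i ρ_i) eⱼ` makes the slackness `∑ gₜᵀμ` at most
`C₁ - f̄ ∑_{t ≥ n} cₜ`, which pays for the periods after `n`; otherwise one compares with `μ = 0`
(`sum_slackness_le`). This gives a pathwise bound in which nothing unbounded is integrated
(`DMDInput.le_totalReward`). The centered terms have mean zero because `μₜ` and the event that
resources are left depend on earlier requests only (`integral_pi_eq_zero_of_centered`).

The step size balances the two regret terms. It is positive unless `b̄ = λ̄ = 0`, in which case all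
targets vanish and the bound is trivial; the constant `C₃` is positive because the assumption on
`E[OPT]` forces `f̄ > 0` (`constC3_pos`).
-/

/-! ### Mirror steps -/

theorem norm_le_sum_abs {m : ℕ} (u : Fin m → ℝ) : ‖u‖ ≤ ∑ j, |u j| :=
  (pi_norm_le_iff_of_nonneg (Finset.sum_nonneg fun _ _ => abs_nonneg _)).2 fun j => by
    rw [Real.norm_eq_abs]
    exact Finset.single_le_sum (f := fun j => |u j|) (fun _ _ => abs_nonneg _) (Finset.mem_univ j)

theorem abs_dotProduct_le {m : ℕ} {C : ℝ} {g : Fin m → ℝ} (hg : ∀ j, |g j| ≤ C)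
    (u : Fin m → ℝ) : |g ⬝ᵥ u| ≤ C * ∑ j, |u j| := by
  rw [dotProduct, Finset.mul_sum]
  refine (Finset.abs_sum_le_sum_abs _ _).trans (Finset.sum_le_sum fun j _ => ?_)
  rw [abs_mul]
  exact mul_le_mul_of_nonneg_right (hg j) (abs_nonneg _)

theorem dotProduct_apply_single {m : ℕ} (F : (Fin m → ℝ) →L[ℝ] ℝ) (u : Fin m → ℝ) :
    (fun j => F (Pi.single j 1)) ⬝ᵥ u = F u := by
  conv_rhs => rw [← Finset.univ_sum_single u]
  rw [map_sum, dotProduct]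
  refine Finset.sum_congr rfl fun j _ => ?_
  have : (Pi.single j (u j) : Fin m → ℝ) = u j • Pi.single j 1 := by
    rw [← Pi.single_smul, smul_eq_mul, mul_one]
  rw [this, map_smul, smul_eq_mul, mul_comm]

theorem eq_of_mul_sq_sum_abs_nonpos {m : ℕ} {σ : ℝ} (hσ : 0 < σ) {u v : Fin m → ℝ}
    (h : σ / 2 * (∑ j, |u j - v j|) ^ 2 ≤ 0) : u = v := by
  have h0 : ∑ j, |u j - v j| = 0 := by
    by_contra hne
    exact absurd h (not_le.2 (by positivity))
  funext j
  have h1 := (Finset.sum_eq_zero_iff_of_nonneg fun _ _ => abs_nonneg _).1 h0 j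
    (Finset.mem_univ j)
  exact sub_eq_zero.1 (abs_eq_zero.1 h1)

namespace IsReferenceFunction

variable {m : ℕ} {h : (Fin m → ℝ) → ℝ} {σ : ℝ}

theorem bregman_ge (hh : IsReferenceFunction h σ) {μ ν : Fin m → ℝ} (hμ : 0 ≤ μ) (hν : 0 ≤ ν)
    (hd : DifferentiableAt ℝ h ν) : σ / 2 * (∑ j, |μ j - ν j|) ^ 2 ≤ bregman h μ ν := by
  have := hh.stronglyConvex μ ν hμ hν hd
  rw [bregman]
  linarith

/-- A linear perturbation of a reference function attains its minimum over `ℝ₊ᵐ`: by strong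
convexity at the point `(1, …, 1)` it is coercive. -/
theorem exists_forall_le (hh : IsReferenceFunction h σ) (hσ : 0 < σ) (θ : Fin m → ℝ) :
    ∃ ν : Fin m → ℝ, 0 ≤ ν ∧ ∀ y : Fin m → ℝ, 0 ≤ y → h ν + θ ⬝ᵥ ν ≤ h y + θ ⬝ᵥ y := by
  have hone : (0 : Fin m → ℝ) ≤ 1 := zero_le_one
  set F := fderiv ℝ h 1
  set C := ‖F‖ + ∑ j, |θ j|
  have hC : 0 ≤ C := add_nonneg (norm_nonneg _) (Finset.sum_nonneg fun _ _ => abs_nonneg _)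
  have hlow : ∀ y : Fin m → ℝ, 0 ≤ y →
      h 1 + θ ⬝ᵥ 1 + (σ / 2 * ∑ j, |y j - 1| - C) * ∑ j, |y j - 1| ≤ h y + θ ⬝ᵥ y := by
    intro y hy
    have h1 := hh.stronglyConvex y 1 hy hone
      (hh.differentiableAt_of_pos 1 fun _ => zero_lt_one)
    simp only [Pi.one_apply] at h1
    have h2 : |F (y - 1)| ≤ ‖F‖ * ∑ j, |y j - 1| :=
      (F.le_opNorm _).trans (mul_le_mul_of_nonneg_left (norm_le_sum_abs _) (norm_nonneg _))
    have h3 : |θ ⬝ᵥ (y - 1)| ≤ (∑ j, |θ j|) * ∑ j, |y j - 1| :=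
      abs_dotProduct_le (fun j => Finset.single_le_sum (f := fun j => |θ j|)
        (fun _ _ => abs_nonneg _) (Finset.mem_univ j)) _
    rw [dotProduct_sub] at h3
    have h4 := neg_abs_le (F (y - 1))
    have h5 := neg_abs_le (θ ⬝ᵥ y - θ ⬝ᵥ 1)
    have h6 : C * ∑ j, |y j - 1| = ‖F‖ * ∑ j, |y j - 1| + (∑ j, |θ j|) * ∑ j, |y j - 1| :=
      add_mul _ _ _
    nlinarith
  let K : Set (Fin m → ℝ) := {y | 0 ≤ y ∧ ∑ j, |y j - 1| ≤ 2 * C / σ}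
  have hKclosed : IsClosed K := by
    refine (isClosed_le continuous_const continuous_id).inter
      (isClosed_le (f := fun y : Fin m → ℝ => ∑ j, |y j - 1|) (by fun_prop) continuous_const)
  have hK : IsCompact K := by
    refine (isCompact_closedBall (1 : Fin m → ℝ) (2 * C / σ)).of_isClosed_subset hKclosed ?_
    intro y hy
    rw [mem_closedBall_iff_norm]
    exact (norm_le_sum_abs _).trans hy.2
  have h1K : (1 : Fin m → ℝ) ∈ K := ⟨hone, by simp; positivity⟩
  obtain ⟨ν, hνK, hν⟩ := hK.exists_isMinOn ⟨1, h1K⟩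
    (f := fun y => h y + θ ⬝ᵥ y)
    ((hh.continuousOn.mono fun y hy => hy.1).add
      (by unfold dotProduct; fun_prop))
  refine ⟨ν, hνK.1, fun y hy => ?_⟩
  by_cases hyK : y ∈ K
  · exact hν hyK
  · have hy2 : 2 * C / σ < ∑ j, |y j - 1| := not_le.1 fun hle => hyK ⟨hy, hle⟩
    have h1 : h ν + θ ⬝ᵥ ν ≤ h 1 + θ ⬝ᵥ 1 := hν h1K
    have h2 : 0 ≤ σ / 2 * ∑ j, |y j - 1| - C := by
      rw [div_lt_iff₀ hσ] at hy2
      linarith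
    have h3 : 0 ≤ ∑ j, |y j - 1| := Finset.sum_nonneg fun _ _ => abs_nonneg _
    linarith [hlow y hy, mul_nonneg h2 h3]

/-- Minimizers over `ℝ₊ᵐ` of linear perturbations of a reference function avoid the points where
it is not differentiable: near such a minimizer `ν`, the perturbed function increases along the
ray `ν + t (1, …, 1)`, and convexity turns this into a bound on its gradients along the ray,
whereas essential smoothness makes them blow up. -/
theorem differentiableAt_of_forall_le (hh : IsReferenceFunction h σ) (hσ : 0 < σ)
    {θ ν : Fin m → ℝ} (hν : 0 ≤ ν)
    (hmin : ∀ y : Fin m → ℝ, 0 ≤ y → h ν + θ ⬝ᵥ ν ≤ h y + θ ⬝ᵥ y) :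
    DifferentiableAt ℝ h ν := by
  by_contra hd
  have hblow := hh.essentiallySmooth ν hν hd
  have hray : Tendsto (fun t : ℝ => ν + t • (1 : Fin m → ℝ)) (𝓝[>] 0)
      (𝓝[{μ | ∀ j, 0 < μ j}] ν) := by
    refine tendsto_nhdsWithin_iff.2 ⟨?_, ?_⟩
    · have : Tendsto (fun t : ℝ => ν + t • (1 : Fin m → ℝ)) (𝓝 0) (𝓝 (ν + (0 : ℝ) • 1)) :=
        Continuous.tendsto (by fun_prop) 0
      rw [zero_smul, add_zero] at this
      exact this.mono_left nhdsWithin_le_nhds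
    · filter_upwards [self_mem_nhdsWithin] with t ht j
      have h0 : 0 ≤ ν j := hν j
      have ht : 0 < t := ht
      simp only [Pi.add_apply, Pi.smul_apply, Pi.one_apply, smul_eq_mul, mul_one]
      linarith
  obtain ⟨M, hM⟩ : ∃ M, ∀ u : Fin m → ℝ, ‖u‖ ≤ 1 → h (ν + 1 + u) + θ ⬝ᵥ (ν + 1 + u) ≤ M := by
    have hcont : ContinuousOn (fun u : Fin m → ℝ => h (ν + 1 + u) + θ ⬝ᵥ (ν + 1 + u))
        (Metric.closedBall 0 1) := by
      refine ContinuousOn.add (hh.continuousOn.comp (by fun_prop) fun u hu j => ?_)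
        (by unfold dotProduct; fun_prop)
      have h0 : 0 ≤ ν j := hν j
      have h1 := (abs_le.1 ((norm_le_pi_norm u j).trans (mem_closedBall_zero_iff.1 hu))).1
      simp only [Pi.add_apply, Pi.one_apply, Pi.zero_apply]
      linarith
    obtain ⟨M, hM⟩ := (isCompact_closedBall (0 : Fin m → ℝ) 1).bddAbove_image hcont
    exact ⟨M, fun u hu => hM ⟨u, mem_closedBall_zero_iff.2 hu, rfl⟩⟩
  set C := max 0 (M - (h ν + θ ⬝ᵥ ν) + ∑ j, |θ j|)
  have hbound : ∀ᶠ t : ℝ in 𝓝[>] 0, ‖fderiv ℝ h (ν + t • (1 : Fin m → ℝ))‖ ≤ C := by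
    filter_upwards [Ioo_mem_nhdsGT (zero_lt_one' ℝ)] with t ⟨ht0, ht1⟩
    have hpos : ∀ j, 0 < (ν + t • (1 : Fin m → ℝ)) j := by
      intro j
      have h0 : 0 ≤ ν j := hν j
      simp only [Pi.add_apply, Pi.smul_apply, Pi.one_apply, smul_eq_mul, mul_one]
      linarith
    set x := ν + t • (1 : Fin m → ℝ) with hx
    have hx0 : 0 ≤ x := fun j => (hpos j).le
    have hconv : ∀ y : Fin m → ℝ, 0 ≤ y → h x + fderiv ℝ h x (y - x) ≤ h y := fun y hy => by
      have h1 := hh.stronglyConvex y x hy hx0 (hh.differentiableAt_of_pos x hpos)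
      have h2 : 0 ≤ σ / 2 * (∑ j, |y j - x j|) ^ 2 := by positivity
      linarith
    have hxmin := hmin x hx0
    have hθx : θ ⬝ᵥ x = θ ⬝ᵥ ν + t * θ ⬝ᵥ 1 := by
      rw [hx, dotProduct_add, dotProduct_smul, smul_eq_mul]
    -- the derivative in the direction `(1, …, 1)` is nonnegative
    have hup : 0 ≤ fderiv ℝ h x 1 + θ ⬝ᵥ 1 := by
      have h1 := hconv ν hν
      rw [hx, sub_add_cancel_left, ← hx, map_neg, map_smul, smul_eq_mul] at h1
      have : 0 ≤ t * (fderiv ℝ h x 1 + θ ⬝ᵥ 1) := by linarith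
      exact nonneg_of_mul_nonneg_right this ht0
    have hdir : ∀ u : Fin m → ℝ, ‖u‖ = 1 → fderiv ℝ h x u ≤ C := fun u hu => by
      have h1 : 0 ≤ ν + 1 + u := fun j => by
        have h0 : 0 ≤ ν j := hν j
        have h1 := (abs_le.1 ((norm_le_pi_norm u j).trans hu.le)).1
        simp only [Pi.add_apply, Pi.one_apply, Pi.zero_apply]
        linarith
      have h2 := hconv _ h1
      have h3 := hM u hu.le
      have h4 : ν + 1 + u - x = (1 - t) • (1 : Fin m → ℝ) + u := by
        rw [hx, sub_smul, one_smul]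
        abel
      rw [h4, map_add, map_smul, smul_eq_mul] at h2
      rw [dotProduct_add, dotProduct_add] at h3
      have h5 : |θ ⬝ᵥ u| ≤ ∑ j, |θ j| := by
        rw [dotProduct_comm]
        refine (abs_dotProduct_le (C := 1) (fun j => ?_) θ).trans_eq (one_mul _)
        exact (norm_le_pi_norm u j).trans hu.le
      have h6 := neg_abs_le (θ ⬝ᵥ u)
      have h7 : 0 ≤ (1 - t) * (fderiv ℝ h x 1 + θ ⬝ᵥ 1) := mul_nonneg (by linarith) hup
      exact le_max_of_le_right (by nlinarith)
    refine ContinuousLinearMap.opNorm_le_of_unit_norm (le_max_left _ _) fun u hu => ?_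
    rw [Real.norm_eq_abs, abs_le]
    have h1 := hdir (-u) (by rw [norm_neg, hu])
    rw [map_neg] at h1
    exact ⟨by linarith, hdir u hu⟩
  obtain ⟨t, ht1, ht2⟩ := (hbound.and ((hblow.comp hray).eventually_gt_atTop C)).exists
  exact absurd ht1 (not_le.2 ht2)

/-- First-order optimality of a minimizer over `ℝ₊ᵐ` of a linear perturbation of `h`. -/
theorem fderiv_add_nonneg_of_forall_le (hh : IsReferenceFunction h σ) (hσ : 0 < σ)
    {θ ν : Fin m → ℝ} (hν : 0 ≤ ν)
    (hmin : ∀ y : Fin m → ℝ, 0 ≤ y → h ν + θ ⬝ᵥ ν ≤ h y + θ ⬝ᵥ y) {y : Fin m → ℝ} (hy : 0 ≤ y) :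
    0 ≤ fderiv ℝ h ν (y - ν) + θ ⬝ᵥ (y - ν) := by
  have hd := (hh.differentiableAt_of_forall_le hσ hν hmin).hasFDerivAt
  -- the difference quotients of the perturbed function on the segment from `ν` to `y`
  have hline : HasDerivAt (fun t : ℝ => h (ν + t • (y - ν)) + t * θ ⬝ᵥ (y - ν))
      (fderiv ℝ h ν (y - ν) + θ ⬝ᵥ (y - ν)) 0 := by
    have h1 : HasDerivAt (fun t : ℝ => ν + t • (y - ν)) (y - ν) 0 := by
      simpa using ((hasDerivAt_id (0 : ℝ)).smul_const (y - ν)).const_add ν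
    have h2 : HasFDerivAt h (fderiv ℝ h ν) (ν + (0 : ℝ) • (y - ν)) := by simpa using hd
    have h3 := h2.comp_hasDerivAt (0 : ℝ) h1
    have h4 : HasDerivAt (fun t : ℝ => t * θ ⬝ᵥ (y - ν)) (θ ⬝ᵥ (y - ν)) 0 := by
      simpa using (hasDerivAt_id (0 : ℝ)).mul_const (θ ⬝ᵥ (y - ν))
    exact h3.add h4
  refine ge_of_tendsto (hline.tendsto_slope_zero_right) ?_
  filter_upwards [Ioo_mem_nhdsGT (zero_lt_one' ℝ)] with t ⟨ht0, ht1⟩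
  have h1 : 0 ≤ ν + t • (y - ν) := fun j => by
    have h2 : 0 ≤ ν j := hν j
    have h3 : 0 ≤ y j := hy j
    simp only [Pi.add_apply, Pi.smul_apply, Pi.sub_apply, Pi.zero_apply, smul_eq_mul]
    nlinarith
  have h2 := hmin _ h1
  rw [dotProduct_add, dotProduct_smul, smul_eq_mul] at h2
  rw [zero_add, zero_smul, add_zero, zero_mul, add_zero, smul_eq_mul]
  exact mul_nonneg (inv_nonneg.2 ht0.le) (by linarith)

theorem add_sq_le_of_forall_le (hh : IsReferenceFunction h σ) (hσ : 0 < σ)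
    {θ ν : Fin m → ℝ} (hν : 0 ≤ ν)
    (hmin : ∀ y : Fin m → ℝ, 0 ≤ y → h ν + θ ⬝ᵥ ν ≤ h y + θ ⬝ᵥ y) {y : Fin m → ℝ} (hy : 0 ≤ y) :
    h ν + θ ⬝ᵥ ν + σ / 2 * (∑ j, |y j - ν j|) ^ 2 ≤ h y + θ ⬝ᵥ y := by
  have h1 := hh.stronglyConvex y ν hy hν (hh.differentiableAt_of_forall_le hσ hν hmin)
  have h2 := hh.fderiv_add_nonneg_of_forall_le hσ hν hmin hy
  rw [dotProduct_sub] at h2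
  linarith

/-- By strong convexity, the minimizer depends continuously on the linear perturbation. -/
theorem continuous_of_forall_le (hh : IsReferenceFunction h σ) (hσ : 0 < σ)
    {f : (Fin m → ℝ) → Fin m → ℝ} (hf : ∀ θ, 0 ≤ f θ)
    (hmin : ∀ θ y : Fin m → ℝ, 0 ≤ y → h (f θ) + θ ⬝ᵥ f θ ≤ h y + θ ⬝ᵥ y) : Continuous f := by
  refine (LipschitzWith.of_dist_le_mul (K := (⟨1 / σ, by positivity⟩ : NNReal))
    fun θ θ' => ?_).continuous
  rw [dist_eq_norm, dist_eq_norm]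
  change _ ≤ 1 / σ * _
  set s := ∑ j, |f θ j - f θ' j| with hs
  have h0 : 0 ≤ s := Finset.sum_nonneg fun _ _ => abs_nonneg _
  have h1 := hh.add_sq_le_of_forall_le hσ (hf θ') (hmin θ') (hf θ)
  have h2 := hh.add_sq_le_of_forall_le hσ (hf θ) (hmin θ) (hf θ')
  have h3 : ∑ j, |f θ' j - f θ j| = s := Finset.sum_congr rfl fun j _ => abs_sub_comm _ _
  rw [h3] at h2
  have h4 : |(θ - θ') ⬝ᵥ (f θ - f θ')| ≤ ‖θ - θ'‖ * s :=
    abs_dotProduct_le (norm_le_pi_norm (θ - θ')) _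
  have h5 := neg_abs_le ((θ - θ') ⬝ᵥ (f θ - f θ'))
  have h6 : (θ - θ') ⬝ᵥ (f θ - f θ') = θ ⬝ᵥ f θ - θ ⬝ᵥ f θ' - θ' ⬝ᵥ f θ + θ' ⬝ᵥ f θ' := by
    rw [dotProduct_sub, sub_dotProduct, sub_dotProduct]
    ring
  have h7 : s * (σ * s) ≤ s * ‖θ - θ'‖ := by nlinarith
  refine (norm_le_sum_abs _).trans ?_
  change s ≤ _
  rcases h0.eq_or_lt with h | h
  · rw [← h]
    positivity
  · rw [one_div, ← div_eq_inv_mul, le_div_iff₀ hσ, mul_comm]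
    exact le_of_mul_le_mul_left h7 h

end IsReferenceFunction

/-- The coefficients of the linear functional which the mirror step from `μ` with gradient `g`
adds to the reference function. -/
noncomputable def mirrorTilt {m : ℕ} (h : (Fin m → ℝ) → ℝ) (η : ℝ) (g μ : Fin m → ℝ) : Fin m → ℝ :=
  η • g - fun j => fderiv ℝ h μ (Pi.single j 1)

theorem isMirrorStep_iff {m : ℕ} {h : (Fin m → ℝ) → ℝ} {η : ℝ} (hη : 0 < η)
    {g μ ν : Fin m → ℝ} :
    IsMirrorStep h η g μ ν ↔ 0 ≤ ν ∧ ∀ y : Fin m → ℝ, 0 ≤ y →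
      h ν + mirrorTilt h η g μ ⬝ᵥ ν ≤ h y + mirrorTilt h η g μ ⬝ᵥ y := by
  have key : ∀ y, h y + mirrorTilt h η g μ ⬝ᵥ y =
      η * (g ⬝ᵥ y + 1 / η * bregman h y μ) + (h μ - fderiv ℝ h μ μ) := fun y => by
    rw [mirrorTilt, sub_dotProduct, dotProduct_apply_single, smul_dotProduct, bregman, map_sub,
      smul_eq_mul]
    field_simp
    ring
  simp only [IsMirrorStep, key, add_le_add_iff_right, mul_le_mul_iff_right₀ hη]

namespace IsReferenceFunction

variable {m : ℕ} {h : (Fin m → ℝ) → ℝ} {σ η : ℝ}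

theorem isMirrorStep_mirrorStep (hh : IsReferenceFunction h σ) (hσ : 0 < σ) (hη : 0 < η)
    (g μ : Fin m → ℝ) : IsMirrorStep h η g μ (mirrorStep h η g μ) := by
  have hex : ∃ ν, IsMirrorStep h η g μ ν := by
    obtain ⟨ν, h1, h2⟩ := hh.exists_forall_le hσ (mirrorTilt h η g μ)
    exact ⟨ν, (isMirrorStep_iff hη).2 ⟨h1, h2⟩⟩
  rw [mirrorStep, dif_pos hex]
  exact hex.choose_spec

theorem mirrorStep_nonneg (hh : IsReferenceFunction h σ) (hσ : 0 < σ) (hη : 0 < η)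
    (g μ : Fin m → ℝ) : 0 ≤ mirrorStep h η g μ :=
  (hh.isMirrorStep_mirrorStep hσ hη g μ).1

theorem differentiableAt_mirrorStep (hh : IsReferenceFunction h σ) (hσ : 0 < σ) (hη : 0 < η)
    (g μ : Fin m → ℝ) : DifferentiableAt ℝ h (mirrorStep h η g μ) :=
  have hs := (isMirrorStep_iff hη).1 (hh.isMirrorStep_mirrorStep hσ hη g μ)
  hh.differentiableAt_of_forall_le hσ hs.1 hs.2

/-- The mirror step is a continuous function of `mirrorTilt`, which is measurable because
gradients are. -/
theorem measurable_mirrorStep (hh : IsReferenceFunction h σ) (hσ : 0 < σ) (hη : 0 < η) :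
    Measurable fun p : (Fin m → ℝ) × (Fin m → ℝ) => mirrorStep h η p.1 p.2 := by
  choose f hf hmin using hh.exists_forall_le hσ
  have heq : ∀ g μ, mirrorStep h η g μ = f (mirrorTilt h η g μ) := fun g μ => by
    have hs := (isMirrorStep_iff hη).1 (hh.isMirrorStep_mirrorStep hσ hη g μ)
    have h1 := hh.add_sq_le_of_forall_le hσ hs.1 hs.2 (hf (mirrorTilt h η g μ))
    have h2 := hmin (mirrorTilt h η g μ) _ hs.1
    have h3 : σ / 2 * (∑ j, |f (mirrorTilt h η g μ) j - mirrorStep h η g μ j|) ^ 2 ≤ 0 := by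
      linarith
    exact (eq_of_mul_sq_sum_abs_nonpos hσ h3).symm
  have htilt : Measurable fun p : (Fin m → ℝ) × (Fin m → ℝ) => mirrorTilt h η p.1 p.2 := by
    refine (measurable_fst.const_smul η).sub (measurable_pi_lambda _ fun j => ?_)
    exact (measurable_fderiv_apply_const ℝ h (Pi.single j 1)).comp measurable_snd
  simp only [heq]
  exact (hh.continuous_of_forall_le hσ hf hmin).measurable.comp htilt

/-- One step of online mirror descent: the regret against `y` is paid for by the decrease of the
Bregman divergence to `y`, up to an error quadratic in the gradient. -/
theorem dotProduct_sub_le (hh : IsReferenceFunction h σ) (hσ : 0 < σ) (hη : 0 < η)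
    {G : ℝ} {g μ y : Fin m → ℝ} (hg : ∀ j, |g j| ≤ G) (hμ : 0 ≤ μ)
    (hd : DifferentiableAt ℝ h μ) (hy : 0 ≤ y) :
    g ⬝ᵥ μ - g ⬝ᵥ y ≤ η * (G ^ 2 / (2 * σ)) +
      (bregman h y μ - bregman h y (mirrorStep h η g μ)) / η := by
  set ν := mirrorStep h η g μ
  have hs := (isMirrorStep_iff hη).1 (hh.isMirrorStep_mirrorStep hσ hη g μ)
  have h1 := hh.fderiv_add_nonneg_of_forall_le hσ hs.1 hs.2 hy
  change 0 ≤ fderiv ℝ h ν (y - ν) + _ ⬝ᵥ (y - ν) at h1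
  rw [mirrorTilt, sub_dotProduct, dotProduct_apply_single, smul_dotProduct, smul_eq_mul] at h1
  have h2 := hh.bregman_ge hs.1 hμ hd
  change σ / 2 * (∑ j, |ν j - μ j|) ^ 2 ≤ bregman h ν μ at h2
  set s := ∑ j, |ν j - μ j|
  have h3 : |g ⬝ᵥ (ν - μ)| ≤ G * s := abs_dotProduct_le hg _
  have h4 := neg_abs_le (g ⬝ᵥ (ν - μ))
  have h5 : bregman h y μ = bregman h y ν + bregman h ν μ +
      (fderiv ℝ h ν (y - ν) - fderiv ℝ h μ (y - ν)) := by
    simp only [bregman, map_sub]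
    ring
  -- the minimum of `σ s² / 2 - η G s` over `s`
  have h6 : η * (G * s) ≤ σ / 2 * s ^ 2 + η * (η * (G ^ 2 / (2 * σ))) := by
    have : σ / 2 * s ^ 2 + η * (η * (G ^ 2 / (2 * σ))) - η * (G * s) =
        (σ * s - η * G) ^ 2 / (2 * σ) := by
      field_simp
      ring
    have : 0 ≤ (σ * s - η * G) ^ 2 / (2 * σ) := by positivity
    linarith
  rw [← sub_le_iff_le_add', le_div_iff₀ hη]
  rw [dotProduct_sub] at h1 h3 h4
  nlinarith

/-- The regret of online mirror descent over `n` steps against `y`. -/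
theorem sum_dotProduct_le (hh : IsReferenceFunction h σ) (hσ : 0 < σ) (hη : 0 < η)
    {G : ℝ} {g μ : ℕ → Fin m → ℝ} {y : Fin m → ℝ} {n : ℕ} (hg : ∀ t < n, ∀ j, |g t j| ≤ G)
    (hμ : 0 ≤ μ 0) (hd : DifferentiableAt ℝ h (μ 0))
    (hstep : ∀ t < n, μ (t + 1) = mirrorStep h η (g t) (μ t)) (hy : 0 ≤ y) :
    ∑ t ∈ Finset.range n, g t ⬝ᵥ μ t ≤ ∑ t ∈ Finset.range n, g t ⬝ᵥ y +
      n * (η * (G ^ 2 / (2 * σ))) + bregman h y (μ 0) / η := by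
  have hiter : ∀ t ≤ n, 0 ≤ μ t ∧ DifferentiableAt ℝ h (μ t) := by
    intro t ht
    cases t with
    | zero => exact ⟨hμ, hd⟩
    | succ t =>
      rw [hstep t ht]
      exact ⟨hh.mirrorStep_nonneg hσ hη _ _, hh.differentiableAt_mirrorStep hσ hη _ _⟩
  have hsum : ∑ t ∈ Finset.range n, (g t ⬝ᵥ μ t - g t ⬝ᵥ y) ≤
      ∑ t ∈ Finset.range n, (η * (G ^ 2 / (2 * σ)) +
        (bregman h y (μ t) / η - bregman h y (μ (t + 1)) / η)) := by
    refine Finset.sum_le_sum fun t ht => ?_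
    have ht := Finset.mem_range.1 ht
    rw [hstep t ht, ← sub_div]
    exact hh.dotProduct_sub_le hσ hη (hg t ht) (hiter t ht.le).1 (hiter t ht.le).2 hy
  rw [Finset.sum_sub_distrib, Finset.sum_add_distrib, Finset.sum_const, Finset.card_range,
    nsmul_eq_mul, Finset.sum_range_sub'] at hsum
  have hlast : 0 ≤ bregman h y (μ n) / η :=
    div_nonneg (le_trans (by positivity)
      (hh.bregman_ge hy (hiter n le_rfl).1 (hiter n le_rfl).2)) hη.le
  linarith

end IsReferenceFunction

/-! ### Regret against the best dual variable in hindsight -/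

/-- The `t`-th summand of `T · c(λ, T)`: the largest share, at most `1`, of the per-period
endowment `ρ_T` that the target `λ_t` covers in all resources. -/
noncomputable def targetShare {m : ℕ} (B : Fin m → ℝ) (lam : ℕ → Fin m → ℝ) (T t : ℕ) : ℝ :=
  min (⨅ j, lam t j / (B j / (T : ℝ))) 1

section Share

variable {m T t : ℕ} {B : Fin m → ℝ} {lam : ℕ → Fin m → ℝ}

theorem targetShare_le_one : targetShare B lam T t ≤ 1 := min_le_right _ _

theorem targetShare_nonneg (hB : ∀ j, 0 < B j) (hlam : 0 ≤ lam t) : 0 ≤ targetShare B lam T t :=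
  le_min (Real.iInf_nonneg fun j => div_nonneg (hlam j)
    (div_nonneg (hB j).le (Nat.cast_nonneg _))) zero_le_one

theorem targetShare_mul_le (hT : 0 < T) (hB : ∀ j, 0 < B j) (j : Fin m) :
    targetShare B lam T t * (B j / T) ≤ lam t j := by
  have hT' : (0 : ℝ) < T := Nat.cast_pos.2 hT
  rw [← le_div_iff₀ (div_pos (hB j) hT')]
  exact (min_le_left _ _).trans (ciInf_le (Set.finite_range _).bddBelow j)

theorem minRho_le (j : Fin m) : minRho B T ≤ B j / T :=
  ciInf_le (Set.finite_range _).bddBelow j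

theorem minRho_pos [NeZero m] (hT : 0 < T) (hB : ∀ j, 0 < B j) : 0 < minRho B T := by
  obtain ⟨j, hj⟩ := exists_eq_ciInf_of_finite (f := fun j => B j / (T : ℝ))
  rw [minRho, ← hj]
  exact div_pos (hB j) (Nat.cast_pos.2 hT)

end Share

theorem mul_stepSize_add_div_eq {C D : ℝ} (hC : 0 < C) (hD : 0 < D) :
    D * √(C / D) + C / √(C / D) = 2 * √(D * C) := by
  have h1 := Real.sq_sqrt hC.le
  have h2 := Real.sq_sqrt hD.le
  have h3 := Real.sqrt_pos.2 hC
  have h4 := Real.sqrt_pos.2 hD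
  rw [Real.sqrt_div hC.le, Real.sqrt_mul hD.le]
  set p := √C
  set q := √D
  rw [← h1, ← h2]
  field_simp
  ring

/-- Complementary slackness paid by the dual variables, up to a period `n` before which the budget
lasts. If some resource `j` is nearly exhausted at `n`, comparing with the dual variable
`(f̄ / min_i ρ_i) e_j` recovers the reward lost after `n`; otherwise one compares with `0`. -/
theorem sum_slackness_le {m : ℕ} [NeZero m] {h : (Fin m → ℝ) → ℝ} {σ η fbar bbar lbar C₁ C₃ : ℝ}
    {B : Fin m → ℝ} {lam a μ : ℕ → Fin m → ℝ} {n T τ₂ : ℕ}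
    (hh : IsReferenceFunction h σ) (hσ : 0 < σ) (hT : 0 < T) (hnT : n ≤ T) (hTτ : T ≤ τ₂)
    (hB : ∀ j, 0 < B j) (htarget : IsTargetSequence B τ₂ lam)
    (hlbar : ∀ t < τ₂, ∀ j, lam t j ≤ lbar) (hf : 0 ≤ fbar) (hb : 0 ≤ bbar)
    (ha0 : ∀ t < n, 0 ≤ a t) (ha : ∀ t < n, ∀ j, a t j ≤ bbar)
    (hC₁ : constC1 fbar bbar B T ≤ C₁) (hC₃ : constC3 fbar h (μ 0) B T ≤ C₃)
    (hC₂pos : 0 < constC2 bbar lbar σ) (hC₃pos : 0 < C₃)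
    (hη : η = √(C₃ / (constC2 bbar lbar σ * τ₂)))
    (hμ : 0 ≤ μ 0) (hd : DifferentiableAt ℝ h (μ 0))
    (hstep : ∀ t < n, μ (t + 1) = mirrorStep h η (lam t - a t) (μ t))
    (hn : n = T ∨ ∃ j, B j - bbar ≤ ∑ t ∈ Finset.range n, a t j) :
    ∑ t ∈ Finset.range n, (lam t - a t) ⬝ᵥ μ t +
        ∑ t ∈ Finset.Ico n T, fbar * targetShare B lam T t ≤
      C₁ + 2 * √(constC2 bbar lbar σ * τ₂ * C₃) := by
  have hτpos : (0 : ℝ) < τ₂ := Nat.cast_pos.2 (hT.trans_le hTτ)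
  have hρ := minRho_pos hT hB
  have hηpos : 0 < η := hη ▸ Real.sqrt_pos.2 (by positivity)
  have hlb : 0 ≤ lbar := (htarget.1 0 (hT.trans_le hTτ) 0).trans (hlbar 0 (hT.trans_le hTτ) 0)
  have hg : ∀ t < n, ∀ j, |(lam t - a t) j| ≤ bbar + lbar := fun t ht j => by
    have htτ : t < τ₂ := ht.trans_le (hnT.trans hTτ)
    have h1 : 0 ≤ lam t j := htarget.1 t htτ j
    have h2 := hlbar t htτ j
    have h3 : 0 ≤ a t j := ha0 t ht j
    have h4 := ha t ht j
    rw [Pi.sub_apply, abs_le]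
    exact ⟨by linarith, by linarith⟩
  have hreg : ∀ y : Fin m → ℝ, 0 ≤ y → bregman h y (μ 0) ≤ C₃ →
      ∑ t ∈ Finset.range n, (lam t - a t) ⬝ᵥ μ t ≤
        ∑ t ∈ Finset.range n, (lam t - a t) ⬝ᵥ y +
          2 * √(constC2 bbar lbar σ * τ₂ * C₃) := fun y hy hy3 => by
    have h1 := hh.sum_dotProduct_le hσ hηpos hg hμ hd hstep hy
    change _ ≤ _ + n * (η * constC2 bbar lbar σ) + _ at h1
    have h2 : (n : ℝ) * (η * constC2 bbar lbar σ) ≤ τ₂ * (η * constC2 bbar lbar σ) :=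
      mul_le_mul_of_nonneg_right (Nat.cast_le.2 (hnT.trans hTτ)) (by positivity)
    have h3 : bregman h y (μ 0) / η ≤ C₃ / η := div_le_div_of_nonneg_right hy3 hηpos.le
    have h4 := mul_stepSize_add_div_eq hC₃pos (mul_pos hC₂pos hτpos)
    rw [← hη] at h4
    linarith
  rcases hn with rfl | ⟨j, hj⟩
  · have h1 := hreg 0 le_rfl ((le_max_left _ _).trans hC₃)
    simp only [dotProduct_zero, Finset.sum_const_zero, zero_add] at h1
    rw [Finset.Ico_self, Finset.sum_empty, add_zero]
    have : 0 ≤ constC1 fbar bbar B n := by unfold constC1; positivity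
    linarith
  · set w := fbar / minRho B T with hw
    have hw0 : 0 ≤ w := by positivity
    have h1 := hreg (Pi.single j w) (Pi.single_nonneg.2 hw0)
      ((le_ciSup (f := fun j => bregman h (Pi.single j (fbar / minRho B T)) (μ 0))
        (Set.finite_range _).bddAbove j).trans ((le_max_right _ _).trans hC₃))
    simp only [dotProduct_single, Pi.sub_apply] at h1
    rw [← Finset.sum_mul, Finset.sum_sub_distrib] at h1
    have h2 : ∑ t ∈ Finset.range n, lam t j + ∑ t ∈ Finset.Ico n T, lam t j ≤ B j := by
      rw [Finset.sum_range_add_sum_Ico _ hnT]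
      have h3 := htarget.2 j
      rw [Finset.sum_apply] at h3
      refine le_trans (Finset.sum_le_sum_of_subset_of_nonneg
        (Finset.range_subset_range.2 hTτ) fun t ht _ => ?_) h3
      exact htarget.1 t (Finset.mem_range.1 ht) j
    have h3 : ∑ t ∈ Finset.Ico n T, fbar * targetShare B lam T t ≤
        (∑ t ∈ Finset.Ico n T, lam t j) * w := by
      rw [Finset.sum_mul]
      refine Finset.sum_le_sum fun t ht => ?_
      have htτ : t < τ₂ := (Finset.mem_Ico.1 ht).2.trans_le hTτ
      have h4 : targetShare B lam T t * minRho B T ≤ lam t j :=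
        (mul_le_mul_of_nonneg_left (minRho_le j)
          (targetShare_nonneg hB (htarget.1 t htτ))).trans (targetShare_mul_le hT hB j)
      calc fbar * targetShare B lam T t = targetShare B lam T t * minRho B T * w := by
            rw [hw]
            field_simp
        _ ≤ lam t j * w := mul_le_mul_of_nonneg_right h4 hw0
    have h4 : bbar * w ≤ C₁ := by
      refine le_trans (le_of_eq ?_) hC₁
      rw [hw, constC1]
      ring
    have h5 : (∑ t ∈ Finset.range n, lam t j - ∑ t ∈ Finset.range n, a t j) * w ≤
        (bbar - ∑ t ∈ Finset.Ico n T, lam t j) * w :=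
      mul_le_mul_of_nonneg_right (by linarith) hw0
    linarith

/-! ### The run of the algorithm on a fixed sequence of requests -/

namespace DMDInput

variable {d m : ℕ} {S : Set (Request d m)} {A : DMDInput S}

/-- The candidate action `x̃ₜ`. -/
noncomputable def candidate (A : DMDInput S) {T : ℕ} (γ : Fin T → S) (t : Fin T) :
    (γ t : Request d m).action :=
  A.rule t (fun s => γ (Fin.castLE t.isLt.le s)) (γ t) (A.state γ t).1

/-- The opportunity-cost-adjusted reward `max_x f(x) - μᵀb(x)` of the request `q = (f, b, 𝒳)`,
for `μ ≥ 0`. It does not depend on how ties are broken; the maximizer for time `0` is used. -/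
def adjustedReward (A : DMDInput S) (q : S) (μ : Fin m → ℝ) : ℝ :=
  (q : Request d m).reward (A.rule 0 Fin.elim0 q μ) -
    μ ⬝ᵥ (q : Request d m).consumption (A.rule 0 Fin.elim0 q μ)

theorem RuleIsArgmax.le_adjustedReward (hrule : A.RuleIsArgmax) {μ : Fin m → ℝ} (hμ : 0 ≤ μ)
    (q : S) (x : (q : Request d m).action) :
    (q : Request d m).reward x - μ ⬝ᵥ (q : Request d m).consumption x ≤
      A.adjustedReward q μ :=
  hrule 0 Fin.elim0 q μ hμ x

theorem RuleIsArgmax.adjustedReward_eq (hrule : A.RuleIsArgmax) {μ : Fin m → ℝ} (hμ : 0 ≤ μ)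
    (q : S) (t : ℕ) (past : Fin t → S) :
    A.adjustedReward q μ = (q : Request d m).reward (A.rule t past q μ) -
      μ ⬝ᵥ (q : Request d m).consumption (A.rule t past q μ) :=
  le_antisymm (hrule t past q μ hμ _) (hrule.le_adjustedReward hμ q _)

theorem RuleIsArgmax.adjustedReward_nonneg (hrule : A.RuleIsArgmax) {μ : Fin m → ℝ} (hμ : 0 ≤ μ)
    (q : S) : 0 ≤ A.adjustedReward q μ := by
  have h1 := hrule.le_adjustedReward hμ q (q : Request d m).null
  rw [Request.null, (q : Request d m).consumption_zero, dotProduct_zero, sub_zero] at h1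
  exact ((q : Request d m).reward_nonneg _).trans h1

theorem adjustedReward_le {fbar : ℝ} (hf : ∀ q ∈ S, ∀ x, q.reward x ≤ fbar) {μ : Fin m → ℝ}
    (hμ : 0 ≤ μ) (q : S) : A.adjustedReward q μ ≤ fbar :=
  (sub_le_self _ (dotProduct_nonneg_of_nonneg hμ ((q : Request d m).consumption_nonneg _))).trans
    (hf q q.2 _)

section Run

variable {T : ℕ} {γ : Fin T → S}

theorem state_succ {t : ℕ} (ht : t < T) : A.state γ (t + 1) =
    (mirrorStep A.refFun A.stepSize (A.target t -
        (γ ⟨t, ht⟩ : Request d m).consumption (A.candidate γ ⟨t, ht⟩)) (A.state γ t).1,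
      (A.state γ t).2 - (γ ⟨t, ht⟩ : Request d m).consumption (A.act γ ⟨t, ht⟩)) := by
  rw [state, dif_pos ht]
  rfl

theorem antitone_remaining : Antitone fun t => (A.state γ t).2 := by
  refine antitone_nat_of_succ_le fun t => ?_
  by_cases ht : t < T
  · rw [state_succ ht]
    exact sub_le_self _ ((γ ⟨t, ht⟩ : Request d m).consumption_nonneg _)
  · rw [state, dif_neg ht]

theorem dual_nonneg {σ : ℝ} (hh : IsReferenceFunction A.refFun σ) (hσ : 0 < σ)
    (hη : 0 < A.stepSize) (hμ : 0 ≤ A.initDual) (t : ℕ) : 0 ≤ (A.state γ t).1 := by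
  induction t with
  | zero => exact hμ
  | succ t ih =>
    by_cases ht : t < T
    · rw [state_succ ht]
      exact hh.mirrorStep_nonneg hσ hη _ _
    · rwa [state, dif_neg ht]

theorem act_eq_candidate {bbar : ℝ} (hb : ∀ q ∈ S, ∀ x j, q.consumption x j ≤ bbar) {t : Fin T}
    (ht : ∀ j, bbar ≤ (A.state γ t).2 j) : A.act γ t = A.candidate γ t :=
  if_pos fun j => (hb _ (γ t).2 _ j).trans (ht j)

open Classical in
/-- A pathwise lower bound for the reward. Here `O` stands for `E[OPT] / T`, and `F μ` for the
expected adjusted reward, so that the hypothesis `hO` is weak duality. The second sum has mean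
zero, because the dual variable and the remaining resources at time `t` are independent of the
`t`-th request. -/
theorem le_totalReward [NeZero m] {σ fbar bbar lbar C₁ C₃ O : ℝ} {F : (Fin m → ℝ) → ℝ} {τ₂ : ℕ}
    (hb : ∀ q ∈ S, ∀ x j, q.consumption x j ≤ bbar)
    (hf0 : 0 ≤ fbar) (hb0 : 0 ≤ bbar) (hT : 0 < T) (hTτ : T ≤ τ₂)
    (hB : ∀ j, 0 < A.budget j)
    (hσ : 0 < σ) (hh : IsReferenceFunction A.refFun σ)
    (hμ₁ : 0 ≤ A.initDual) (hμ₁' : DifferentiableAt ℝ A.refFun A.initDual)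
    (hrule : A.RuleIsArgmax) (htarget : IsTargetSequence A.budget τ₂ A.target)
    (hlbar : ∀ t < τ₂, ∀ j, A.target t j ≤ lbar)
    (hC₁ : constC1 fbar bbar A.budget T ≤ C₁)
    (hC₃ : constC3 fbar A.refFun A.initDual A.budget T ≤ C₃)
    (hC₂pos : 0 < constC2 bbar lbar σ) (hC₃pos : 0 < C₃)
    (hη : A.stepSize = √(C₃ / (constC2 bbar lbar σ * τ₂)))
    (hO : ∀ μ : Fin m → ℝ, 0 ≤ μ → O ≤ F μ + ∑ j, A.budget j / T * μ j) (hOf : O ≤ fbar) :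
    ∑ t : Fin T, targetShare A.budget A.target T t * O +
        ∑ t : Fin T, targetShare A.budget A.target T t *
          (if ∀ j, bbar ≤ (A.state γ t).2 j then
            A.adjustedReward (γ t) (A.state γ t).1 - F (A.state γ t).1 else 0) -
        (C₁ + 2 * √(constC2 bbar lbar σ * τ₂ * C₃)) ≤ A.totalReward T γ := by
  have hηpos : 0 < A.stepSize := by
    have : (0 : ℝ) < τ₂ := Nat.cast_pos.2 (hT.trans_le hTτ)
    exact hη ▸ Real.sqrt_pos.2 (by positivity)
  -- `n` is the first period in which some resource may run out
  obtain ⟨n, hnT, hlt, hge⟩ : ∃ n ≤ T, (∀ t < n, ∀ j, bbar ≤ (A.state γ t).2 j) ∧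
      (n = T ∨ ¬ ∀ j, bbar ≤ (A.state γ n).2 j) := by
    have hex : ∃ n, T ≤ n ∨ ¬ ∀ j, bbar ≤ (A.state γ n).2 j := ⟨T, Or.inl le_rfl⟩
    have hle : Nat.find hex ≤ T := Nat.find_min' hex (Or.inl le_rfl)
    refine ⟨Nat.find hex, hle, fun t ht => ?_, (Nat.find_spec hex).imp_left hle.antisymm⟩
    exact not_not.1 fun hnot => Nat.find_min hex ht (Or.inr hnot)
  let a : ℕ → Fin m → ℝ := fun t =>
    if ht : t < T then (γ ⟨t, ht⟩ : Request d m).consumption (A.candidate γ ⟨t, ht⟩) else 0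
  have ha_eq : ∀ t (ht : t < T),
      a t = (γ ⟨t, ht⟩ : Request d m).consumption (A.candidate γ ⟨t, ht⟩) :=
    fun t ht => dif_pos ht
  have hremaining : ∀ k ≤ n, (A.state γ k).2 = A.budget - ∑ t ∈ Finset.range k, a t := by
    intro k
    induction k with
    | zero => intro _; simp [state]
    | succ k ih =>
      intro hk
      have hkT : k < T := (Nat.lt_of_succ_le hk).trans_le hnT
      rw [state_succ hkT, act_eq_candidate hb (t := ⟨k, hkT⟩) (hlt k hk), ih (Nat.le_of_succ_le hk),
        Finset.sum_range_succ, ha_eq k hkT, sub_sub]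
  have hslack := sum_slackness_le (μ := fun t => (A.state γ t).1) (a := a) hh hσ hT hnT hTτ hB
    htarget hlbar hf0 hb0
    (fun t ht => by
      rw [ha_eq t (ht.trans_le hnT)]
      exact (γ ⟨t, ht.trans_le hnT⟩ : Request d m).consumption_nonneg _)
    (fun t ht j => by
      rw [ha_eq t (ht.trans_le hnT)]
      exact hb _ (γ ⟨t, ht.trans_le hnT⟩).2 _ j)
    hC₁ hC₃ hC₂pos hC₃pos hη hμ₁ hμ₁'
    (fun t ht => by
      rw [state_succ (ht.trans_le hnT), ha_eq t (ht.trans_le hnT)])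
    (hge.imp_right fun hnot => by
      obtain ⟨j, hj⟩ := not_forall.1 hnot
      rw [hremaining n le_rfl, Pi.sub_apply, Finset.sum_apply] at hj
      exact ⟨j, by linarith⟩)
  have hsplit : ∑ t : Fin T, (if (t : ℕ) < n then
      (A.target t - a t) ⬝ᵥ (A.state γ t).1 else fbar * targetShare A.budget A.target T t) =
      ∑ t ∈ Finset.range n, (A.target t - a t) ⬝ᵥ (A.state γ t).1 +
        ∑ t ∈ Finset.Ico n T, fbar * targetShare A.budget A.target T t := by
    rw [← Finset.sum_range (fun t => if t < n then
      (A.target t - a t) ⬝ᵥ (A.state γ t).1 else fbar * targetShare A.budget A.target T t),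
      ← Finset.sum_range_add_sum_Ico _ hnT]
    congr 1
    · exact Finset.sum_congr rfl fun t ht => if_pos (Finset.mem_range.1 ht)
    · exact Finset.sum_congr rfl fun t ht => if_neg (not_lt.2 (Finset.mem_Ico.1 ht).1)
  rw [← hsplit] at hslack
  refine le_trans (sub_le_sub_left hslack _) ?_
  rw [← Finset.sum_add_distrib, ← Finset.sum_sub_distrib, totalReward]
  refine Finset.sum_le_sum fun t _ => ?_
  set c := targetShare A.budget A.target T t
  have htτ : (t : ℕ) < τ₂ := t.2.trans_le hTτ
  have hc0 : 0 ≤ c := targetShare_nonneg hB (htarget.1 t htτ)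
  by_cases htn : (t : ℕ) < n
  · rw [if_pos (hlt t htn), if_pos htn, act_eq_candidate hb (hlt t htn), ha_eq t t.2]
    set μ := (A.state γ t).1
    have hμ : 0 ≤ μ := dual_nonneg hh hσ hηpos hμ₁ t
    have h1 : A.adjustedReward (γ t) μ = (γ t : Request d m).reward (A.candidate γ t) -
        μ ⬝ᵥ (γ t : Request d m).consumption (A.candidate γ t) :=
      hrule.adjustedReward_eq hμ _ _ _
    have h2 : c * A.adjustedReward (γ t) μ ≤ A.adjustedReward (γ t) μ :=
      mul_le_of_le_one_left (hrule.adjustedReward_nonneg hμ _) targetShare_le_one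
    have h3 : c * ∑ j, A.budget j / T * μ j ≤ A.target t ⬝ᵥ μ := by
      rw [Finset.mul_sum]
      refine Finset.sum_le_sum fun j _ => ?_
      rw [← mul_assoc]
      exact mul_le_mul_of_nonneg_right (targetShare_mul_le hT hB j) (hμ j)
    have h4 := mul_le_mul_of_nonneg_left (hO μ hμ) hc0
    rw [sub_dotProduct, dotProduct_comm _ μ, dotProduct_comm _ μ]
    rw [dotProduct_comm] at h3
    change _ - (_ - μ ⬝ᵥ (γ t : Request d m).consumption (A.candidate γ t)) ≤ _
    linarith
  · have hnot : ¬ ∀ j, bbar ≤ (A.state γ t).2 j := fun hall => by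
      rcases hge with rfl | hn
      · exact htn t.2
      · exact hn fun j => (hall j).trans (antitone_remaining (not_lt.1 htn) j)
    rw [if_neg hnot, if_neg htn, mul_zero, add_zero]
    have h1 := mul_le_mul_of_nonneg_left hOf hc0
    have h2 := (γ t : Request d m).reward_nonneg (A.act γ t)
    linarith

end Run

end DMDInput

/-! ### Expectations -/

section Independence

variable {S : Type*} [MeasurableSpace S] {P : Measure S} [IsProbabilityMeasure P] {T : ℕ}

theorem measurable_past_prodMk (t : Fin T) : Measurable fun γ : Fin T → S =>
    ((fun s : Fin t => γ (Fin.castLE t.isLt.le s)), γ t) :=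
  (measurable_pi_lambda _ fun _ => measurable_pi_apply _).prodMk (measurable_pi_apply t)

/-- A function of the first `t + 1` coordinates which is centered in the last of them, given the
others, has mean zero under a product measure. -/
theorem integral_pi_eq_zero_of_centered (t : Fin T) {k : (Fin t → S) × S → ℝ}
    (hk : Measurable k) (hzero : ∀ p, ∫ q, k (p, q) ∂P = 0) :
    ∫ γ : Fin T → S, k (fun s => γ (Fin.castLE t.isLt.le s), γ t)
      ∂(Measure.pi fun _ : Fin T => P) = 0 := by
  have hpast : Measurable fun (γ : Fin T → S) (s : Fin t) => γ (Fin.castLE t.isLt.le s) :=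
    measurable_pi_lambda _ fun s => measurable_pi_apply _
  have hind : ProbabilityTheory.IndepFun
      (fun (γ : Fin T → S) (s : Fin t) => γ (Fin.castLE t.isLt.le s)) (fun γ => γ t)
      (Measure.pi fun _ : Fin T => P) := by
    have h1 := (ProbabilityTheory.iIndepFun_pi (μ := fun _ : Fin T => P) (X := fun _ q => q)
      fun _ => aemeasurable_id).indepFun_finset (Finset.univ.filter (· < t)) {t} (by simp)
      fun i => measurable_pi_apply i
    have hlast : Measurable fun p : ({t} : Finset (Fin T)) → S =>
        p ⟨t, Finset.mem_singleton_self t⟩ := measurable_pi_apply (X := fun _ => S) _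
    exact h1.comp
      (φ := fun p (s : Fin t) =>
        p ⟨Fin.castLE t.isLt.le s, Finset.mem_filter.2 ⟨Finset.mem_univ _, s.2⟩⟩)
      (ψ := fun p => p ⟨t, Finset.mem_singleton_self t⟩)
      (measurable_pi_lambda _ fun s => measurable_pi_apply _)
      hlast
  have hmap := (ProbabilityTheory.indepFun_iff_map_prod_eq_prod_map_map hpast.aemeasurable
    (measurable_pi_apply t).aemeasurable).1 hind
  have hev : (Measure.pi fun _ : Fin T => P).map (fun γ => γ t) = P :=
    (measurePreserving_eval (fun _ : Fin T => P) t).map_eq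
  have : IsProbabilityMeasure ((Measure.pi fun _ : Fin T => P).map
      fun γ (s : Fin t) => γ (Fin.castLE t.isLt.le s)) :=
    Measure.isProbabilityMeasure_map hpast.aemeasurable
  rw [hev] at hmap
  rw [← integral_map (φ := fun γ : Fin T → S => (fun s : Fin t => γ (Fin.castLE t.isLt.le s), γ t))
    (measurable_past_prodMk t).aemeasurable hk.aestronglyMeasurable, hmap]
  by_cases hint : Integrable k ((Measure.map (fun (γ : Fin T → S) (s : Fin t) =>
      γ (Fin.castLE t.isLt.le s)) (Measure.pi fun _ : Fin T => P)).prod P)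
  · rw [integral_prod _ hint]
    simp only [hzero, integral_zero]
  · exact integral_undef hint

end Independence

namespace DMDInput

variable {d m : ℕ} {S : Set (Request d m)} {A : DMDInput S}

/-- The state at time `t ≤ n` depends on the first `n` requests only. -/
theorem state_comp_castLE {n T : ℕ} (hn : n ≤ T) (γ : Fin T → S) {t : ℕ} (ht : t ≤ n) :
    A.state (fun s : Fin n => γ (Fin.castLE hn s)) t = A.state γ t := by
  induction t with
  | zero => rfl
  | succ t ih =>
    have htn : t < n := Nat.lt_of_succ_le ht
    rw [state, state, dif_pos htn, dif_pos (htn.trans_le hn)]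
    simp only [ih htn.le]
    rfl

section Measurability

variable [MeasurableSpace S] {T : ℕ}

theorem RuleIsMeasurable.measurable_adjustedReward (hmeas : A.RuleIsMeasurable) :
    Measurable fun p : S × (Fin m → ℝ) => A.adjustedReward p.1 p.2 := by
  have hemb : Measurable fun p : S × (Fin m → ℝ) => ((Fin.elim0 : Fin 0 → S), p.1, p.2) :=
    measurable_const.prodMk (measurable_fst.prodMk measurable_snd)
  have hr := (hmeas.2 0).1.comp hemb
  have hc := (hmeas.2 0).2.comp hemb
  refine hr.sub (Finset.measurable_sum _ fun j _ => ?_)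
  exact ((measurable_pi_apply j).comp measurable_snd).mul ((measurable_pi_apply j).comp hc)

theorem measurable_observation {t : ℕ} (ht : t < T) (hs : Measurable fun γ : Fin T → S =>
    A.state γ t) : Measurable fun γ : Fin T → S =>
      ((fun s : Fin t => γ (Fin.castLE ht.le s)), γ ⟨t, ht⟩, (A.state γ t).1) :=
  (measurable_pi_lambda _ fun _ => measurable_pi_apply _).prodMk
    ((measurable_pi_apply _).prodMk (measurable_fst.comp hs))

theorem RuleIsMeasurable.measurable_state (hmeas : A.RuleIsMeasurable) {σ : ℝ}
    (hh : IsReferenceFunction A.refFun σ) (hσ : 0 < σ) (hη : 0 < A.stepSize) (t : ℕ) :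
    Measurable fun γ : Fin T → S => A.state γ t := by
  classical
  induction t with
  | zero => exact measurable_const
  | succ t ih =>
    by_cases ht : t < T
    · have hcons : Measurable fun γ : Fin T → S =>
          (γ ⟨t, ht⟩ : Request d m).consumption (A.candidate γ ⟨t, ht⟩) :=
        (hmeas.2 t).2.comp (measurable_observation ht ih)
      have hR : Measurable fun γ : Fin T → S => (A.state γ t).2 := measurable_snd.comp ih
      have hact : (fun γ : Fin T → S =>
          (γ ⟨t, ht⟩ : Request d m).consumption (A.act γ ⟨t, ht⟩)) = fun γ =>
          if (γ ⟨t, ht⟩ : Request d m).consumption (A.candidate γ ⟨t, ht⟩) ≤ (A.state γ t).2 then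
            (γ ⟨t, ht⟩ : Request d m).consumption (A.candidate γ ⟨t, ht⟩) else 0 := by
        funext γ
        by_cases hfit : (γ ⟨t, ht⟩ : Request d m).consumption (A.candidate γ ⟨t, ht⟩) ≤
            (A.state γ t).2
        · rw [if_pos hfit]
          exact congrArg _ (if_pos hfit)
        · rw [if_neg hfit]
          exact (congrArg _ (if_neg hfit)).trans (γ ⟨t, ht⟩ : Request d m).consumption_zero
      simp only [state_succ ht]
      refine Measurable.prodMk ?_ (hR.sub ?_)
      · exact (hh.measurable_mirrorStep hσ hη).comp
          ((measurable_const.sub hcons).prodMk (measurable_fst.comp ih))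
      · rw [hact]
        exact Measurable.ite (measurableSet_le hcons hR) hcons measurable_const
    · simpa only [state, dif_neg ht] using ih

theorem RuleIsMeasurable.measurable_totalReward (hmeas : A.RuleIsMeasurable) {σ : ℝ}
    (hh : IsReferenceFunction A.refFun σ) (hσ : 0 < σ) (hη : 0 < A.stepSize) :
    Measurable fun γ : Fin T → S => A.totalReward T γ := by
  classical
  refine Finset.measurable_sum _ fun t _ => ?_
  have hs := hmeas.measurable_state (T := T) hh hσ hη t
  have hobs := measurable_observation t.2 hs
  have hact : (fun γ : Fin T → S => (γ t : Request d m).reward (A.act γ t)) = fun γ =>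
      if (γ t : Request d m).consumption (A.candidate γ t) ≤ (A.state γ t).2 then
        (γ t : Request d m).reward (A.candidate γ t) else
        (γ t : Request d m).reward (γ t : Request d m).null := by
    funext γ
    by_cases hfit : (γ t : Request d m).consumption (A.candidate γ t) ≤ (A.state γ t).2
    · rw [if_pos hfit]
      exact congrArg _ (if_pos hfit)
    · rw [if_neg hfit]
      exact congrArg _ (if_neg hfit)
  rw [hact]
  exact Measurable.ite (measurableSet_le ((hmeas.2 t).2.comp hobs) (measurable_snd.comp hs))
    ((hmeas.2 t).1.comp hobs) (hmeas.1.comp (measurable_pi_apply t))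

end Measurability

theorem totalReward_nonneg {T : ℕ} (γ : Fin T → S) : 0 ≤ A.totalReward T γ :=
  Finset.sum_nonneg fun t _ => (γ t : Request d m).reward_nonneg _

section Hindsight

variable {fbar : ℝ} {B : Fin m → ℝ} {T : ℕ}

theorem _root_.hindsightOpt_le {M : ℝ} (hB : 0 ≤ B) (γ : Fin T → S)
    (hM : ∀ x : (t : Fin T) → (γ t : Request d m).action,
      ∑ t, (γ t : Request d m).consumption (x t) ≤ B →
        ∑ t, (γ t : Request d m).reward (x t) ≤ M) : hindsightOpt B T γ ≤ M := by
  refine csSup_le ⟨_, fun t => (γ t : Request d m).null, ?_, rfl⟩ ?_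
  · exact (Finset.sum_eq_zero fun t _ => (γ t : Request d m).consumption_zero).trans_le hB
  · rintro r ⟨x, hx, rfl⟩
    exact hM x hx

variable [MeasurableSpace S] {P : Measure S} [IsProbabilityMeasure P]

theorem integral_hindsightOpt_le_mul (hf : ∀ q ∈ S, ∀ x, q.reward x ≤ fbar) (hB : 0 ≤ B)
    (hint : Integrable (hindsightOpt B T) (Measure.pi fun _ : Fin T => P)) :
    ∫ γ, hindsightOpt B T γ ∂(Measure.pi fun _ : Fin T => P) ≤ T * fbar := by
  refine (integral_mono hint (integrable_const (T * fbar)) fun γ => ?_).trans_eq (by simp)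
  refine hindsightOpt_le hB γ fun x _ => ?_
  refine (Finset.sum_le_sum fun t _ => hf _ (γ t).2 (x t)).trans_eq ?_
  simp

theorem RuleIsMeasurable.integrable_adjustedReward (hmeas : A.RuleIsMeasurable)
    (hrule : A.RuleIsArgmax) (hf : ∀ q ∈ S, ∀ x, q.reward x ≤ fbar) {μ : Fin m → ℝ} (hμ : 0 ≤ μ) :
    Integrable (fun q => A.adjustedReward q μ) P := by
  refine Integrable.of_bound (hmeas.measurable_adjustedReward.comp
    (measurable_id.prodMk measurable_const)).aestronglyMeasurable fbar (ae_of_all _ fun q => ?_)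
  change |A.adjustedReward q μ| ≤ _
  rw [abs_of_nonneg (hrule.adjustedReward_nonneg hμ q)]
  exact adjustedReward_le hf hμ q

/-- Weak duality, in expectation. -/
theorem integral_hindsightOpt_le_dual (hmeas : A.RuleIsMeasurable) (hrule : A.RuleIsArgmax)
    (hf : ∀ q ∈ S, ∀ x, q.reward x ≤ fbar) (hB : 0 ≤ B)
    (hint : Integrable (hindsightOpt B T) (Measure.pi fun _ : Fin T => P))
    {μ : Fin m → ℝ} (hμ : 0 ≤ μ) :
    ∫ γ, hindsightOpt B T γ ∂(Measure.pi fun _ : Fin T => P) ≤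
      T * ∫ q, A.adjustedReward q μ ∂P + μ ⬝ᵥ B := by
  have hadj := hmeas.integrable_adjustedReward (P := P) hrule hf hμ
  have hterm : ∀ t : Fin T, Integrable (fun γ : Fin T → S => A.adjustedReward (γ t) μ)
      (Measure.pi fun _ : Fin T => P) := fun t =>
    (measurePreserving_eval (fun _ : Fin T => P) t).integrable_comp_of_integrable hadj
  have hmean : ∀ t : Fin T, ∫ γ : Fin T → S, A.adjustedReward (γ t) μ
      ∂(Measure.pi fun _ : Fin T => P) = ∫ q, A.adjustedReward q μ ∂P := fun t => by
    have h1 := measurePreserving_eval (fun _ : Fin T => P) t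
    have h2 := integral_map (f := fun q => A.adjustedReward q μ) h1.aemeasurable
      (h1.map_eq.symm ▸ hadj.aestronglyMeasurable)
    rw [h1.map_eq] at h2
    exact h2.symm
  have hsum := integrable_finsetSum Finset.univ fun t _ => hterm t
  refine (integral_mono hint (hsum.add (integrable_const (μ ⬝ᵥ B))) fun γ => ?_).trans_eq ?_
  · refine hindsightOpt_le hB γ fun x hx => ?_
    have h1 : ∑ t, ((γ t : Request d m).reward (x t) -
        μ ⬝ᵥ (γ t : Request d m).consumption (x t)) ≤ ∑ t, A.adjustedReward (γ t) μ :=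
      Finset.sum_le_sum fun t _ => hrule.le_adjustedReward hμ _ _
    rw [Finset.sum_sub_distrib, ← dotProduct_sum] at h1
    have h2 := dotProduct_le_dotProduct_of_nonneg_left hx hμ
    change _ ≤ ∑ t, A.adjustedReward (γ t) μ + μ ⬝ᵥ B
    linarith
  · rw [integral_add' hsum (integrable_const _), integral_finsetSum _ fun t _ => hterm t]
    simp [hmean]

end Hindsight

/-- The bound on the expected reward, for positive regret constants. -/
theorem sub_le_integral_totalReward [NeZero m] [MeasurableSpace S] {P : Measure S}
    [IsProbabilityMeasure P] {T τ₂ : ℕ} {σ fbar bbar lbar C₁ C₃ : ℝ}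
    (hf : ∀ q ∈ S, ∀ x, q.reward x ≤ fbar) (hb : ∀ q ∈ S, ∀ x j, q.consumption x j ≤ bbar)
    (hf0 : 0 ≤ fbar) (hb0 : 0 ≤ bbar) (hT : 0 < T) (hTτ : T ≤ τ₂)
    (hB : ∀ j, 0 < A.budget j) (hσ : 0 < σ) (hh : IsReferenceFunction A.refFun σ)
    (hμ₁ : 0 ≤ A.initDual) (hμ₁' : DifferentiableAt ℝ A.refFun A.initDual)
    (hrule : A.RuleIsArgmax) (hmeas : A.RuleIsMeasurable)
    (htarget : IsTargetSequence A.budget τ₂ A.target)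
    (hlbar : ∀ t < τ₂, ∀ j, A.target t j ≤ lbar)
    (hC₁ : constC1 fbar bbar A.budget T ≤ C₁)
    (hC₃ : constC3 fbar A.refFun A.initDual A.budget T ≤ C₃)
    (hC₂pos : 0 < constC2 bbar lbar σ) (hC₃pos : 0 < C₃)
    (hη : A.stepSize = √(C₃ / (constC2 bbar lbar σ * τ₂)))
    (hint : Integrable (hindsightOpt A.budget T) (Measure.pi fun _ : Fin T => P)) :
    targetRatio A.budget A.target T *
        (∫ γ, hindsightOpt A.budget T γ ∂(Measure.pi fun _ : Fin T => P)) -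
      (C₁ + 2 * √(constC2 bbar lbar σ * τ₂ * C₃)) ≤
        ∫ γ, A.totalReward T γ ∂(Measure.pi fun _ : Fin T => P) := by
  classical
  have hTpos : (0 : ℝ) < T := Nat.cast_pos.2 hT
  have hηpos : 0 < A.stepSize := by
    have : (0 : ℝ) < τ₂ := Nat.cast_pos.2 (hT.trans_le hTτ)
    exact hη ▸ Real.sqrt_pos.2 (by positivity)
  set I := ∫ γ, hindsightOpt A.budget T γ ∂(Measure.pi fun _ : Fin T => P)
  set F : (Fin m → ℝ) → ℝ := fun μ => ∫ q, A.adjustedReward q μ ∂P with hF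
  have hFmeas : Measurable F :=
    (hmeas.measurable_adjustedReward.stronglyMeasurable.integral_prod_left
      (f := fun q μ => A.adjustedReward q μ)).measurable
  have hF0 : ∀ μ : Fin m → ℝ, 0 ≤ μ → 0 ≤ F μ := fun μ hμ =>
    integral_nonneg fun q => hrule.adjustedReward_nonneg hμ q
  have hFle : ∀ μ : Fin m → ℝ, 0 ≤ μ → F μ ≤ fbar := fun μ hμ =>
    (integral_mono (hmeas.integrable_adjustedReward hrule hf hμ) (integrable_const fbar)
      fun q => adjustedReward_le hf hμ q).trans_eq (by simp)
  have hO : ∀ μ : Fin m → ℝ, 0 ≤ μ → I / T ≤ F μ + ∑ j, A.budget j / T * μ j := fun μ hμ => by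
    have h1 := integral_hindsightOpt_le_dual hmeas hrule hf (fun j => (hB j).le) hint hμ
    have h2 : F μ + ∑ j, A.budget j / T * μ j = (T * F μ + μ ⬝ᵥ A.budget) / T := by
      rw [add_div, mul_div_cancel_left₀ _ hTpos.ne', dotProduct, Finset.sum_div]
      exact congrArg _ (Finset.sum_congr rfl fun j _ => by ring)
    rw [h2]
    exact div_le_div_of_nonneg_right h1 hTpos.le
  have hOf : I / T ≤ fbar := by
    rw [div_le_iff₀' hTpos]
    exact integral_hindsightOpt_le_mul hf (fun j => (hB j).le) hint
  -- the centered part of the adjusted reward, as a function of the past and the present request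
  let k : (t : Fin T) → (Fin t → S) × S → ℝ := fun t p =>
    if ∀ j, bbar ≤ (A.state p.1 t).2 j then
      A.adjustedReward p.2 (A.state p.1 t).1 - F (A.state p.1 t).1 else 0
  have hkmeas : ∀ t, Measurable (k t) := fun t => by
    have hs : Measurable fun p : (Fin t → S) × S => A.state p.1 t :=
      (hmeas.measurable_state hh hσ hηpos t).comp measurable_fst
    refine Measurable.ite ?_ ?_ measurable_const
    · simp only [Set.ofPred_forall]
      exact MeasurableSet.iInter fun j => measurableSet_le measurable_const
        ((measurable_pi_apply j).comp (measurable_snd.comp hs))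
    · exact (hmeas.measurable_adjustedReward.comp
        (measurable_snd.prodMk (measurable_fst.comp hs))).sub
        (hFmeas.comp (measurable_fst.comp hs))
  have hkzero : ∀ t p, ∫ q, k t (p, q) ∂P = 0 := fun t p => by
    have hμ := dual_nonneg (γ := p) hh hσ hηpos hμ₁ t
    by_cases halive : ∀ j, bbar ≤ (A.state p t).2 j
    · simp only [k, if_pos halive]
      rw [integral_sub (hmeas.integrable_adjustedReward hrule hf hμ) (integrable_const _)]
      simp [hF]
    · simp only [k, if_neg halive, integral_zero]
  have hkbound : ∀ t p, |k t p| ≤ fbar := fun t p => by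
    have hμ := dual_nonneg (γ := p.1) hh hσ hηpos hμ₁ t
    by_cases halive : ∀ j, bbar ≤ (A.state p.1 t).2 j
    · simp only [k, if_pos halive]
      have h1 := hrule.adjustedReward_nonneg hμ p.2
      have h2 := adjustedReward_le (A := A) hf hμ p.2
      rw [abs_le]
      constructor <;> linarith [hF0 _ hμ, hFle _ hμ]
    · simpa only [k, if_neg halive, abs_zero] using hf0
  let g : Fin T → (Fin T → S) → ℝ := fun t γ =>
    targetShare A.budget A.target T t * k t (fun s => γ (Fin.castLE t.isLt.le s), γ t)
  have hgint : ∀ t : Fin T, Integrable (g t) (Measure.pi fun _ : Fin T => P) := fun t => by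
    refine Integrable.const_mul (Integrable.of_bound ?_ fbar (ae_of_all _ fun γ =>
      hkbound t _)) _
    exact ((hkmeas t).comp (measurable_past_prodMk t)).aestronglyMeasurable
  have hgzero : ∀ t : Fin T, ∫ γ, g t γ ∂(Measure.pi fun _ : Fin T => P) = 0 := fun t => by
    simp only [g]
    rw [integral_const_mul, integral_pi_eq_zero_of_centered t (hkmeas t) (hkzero t), mul_zero]
  have hRint : Integrable (fun γ : Fin T → S => A.totalReward T γ)
      (Measure.pi fun _ : Fin T => P) := by
    refine Integrable.of_bound (hmeas.measurable_totalReward hh hσ hηpos).aestronglyMeasurable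
      (T * fbar) (ae_of_all _ fun γ => ?_)
    rw [Real.norm_eq_abs, abs_of_nonneg (totalReward_nonneg γ)]
    refine (Finset.sum_le_sum fun t _ => hf _ (γ t).2 (A.act γ t)).trans_eq ?_
    simp
  have hsum : Integrable (fun γ => ∑ t, g t γ) (Measure.pi fun _ : Fin T => P) :=
    integrable_finsetSum Finset.univ fun t _ => hgint t
  set E := C₁ + 2 * √(constC2 bbar lbar σ * τ₂ * C₃)
  have hpath : ∀ γ : Fin T → S, ∑ t : Fin T, targetShare A.budget A.target T t * (I / T) - E +
      ∑ t, g t γ ≤ A.totalReward T γ := fun γ => by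
    have h1 := le_totalReward (γ := γ) hb hf0 hb0 hT hTτ hB hσ hh hμ₁ hμ₁' hrule htarget
      hlbar hC₁ hC₃ hC₂pos hC₃pos hη hO hOf
    simp only [g, k, state_comp_castLE _ γ le_rfl]
    rwa [sub_add_eq_add_sub]
  have hmono := integral_mono ((integrable_const _).add hsum) hRint hpath
  rw [integral_add' (integrable_const _) hsum, integral_finsetSum _ fun t _ => hgint t,
    Finset.sum_eq_zero fun t _ => hgzero t, add_zero, integral_const, probReal_univ,
    one_smul] at hmono
  refine le_trans (le_of_eq ?_) hmono
  rw [← Finset.sum_mul, Fin.sum_univ_eq_sum_range (fun t => targetShare A.budget A.target T t) T,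
    targetRatio]
  simp only [targetShare]
  ring

end DMDInput

/-! ### The regret constants and the error term -/

theorem masterError_eq {κ C₁ C₂ C₃ τ₁ τ₂ : ℝ} (hτ₁ : 0 < τ₁) :
    masterError κ C₁ C₂ C₃ τ₁ τ₂ = (C₁ + 2 * √(C₂ * τ₂ * C₃)) / (κ * τ₁) := by
  have h1 : τ₂ / τ₁ * C₂ * C₃ = C₂ * τ₂ * C₃ / τ₁ := by ring
  rw [masterError, h1, Real.sqrt_div' _ hτ₁.le, add_div]
  have h2 := Real.sqrt_pos.2 hτ₁
  have h3 : κ * τ₁ = κ * √τ₁ * √τ₁ := by rw [mul_assoc, Real.mul_self_sqrt hτ₁.le]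
  rw [← mul_div_assoc, div_div, mul_comm √τ₁, ← h3]

theorem masterError_nonneg {κ C₁ C₂ C₃ τ₁ τ₂ : ℝ} (hκ : 0 ≤ κ) (hC₁ : 0 ≤ C₁) (hτ₁ : 0 ≤ τ₁) :
    0 ≤ masterError κ C₁ C₂ C₃ τ₁ τ₂ := by
  unfold masterError
  positivity

theorem tendsto_masterError {r K κ₀ : ℝ} (hκ₀ : 0 < κ₀) {k c₁ c₂ c₃ s₁ s₂ : ℕ → ℝ}
    (hk : ∀ n, κ₀ ≤ k n) (hc₁ : ∀ n, c₁ n ∈ Set.Icc 0 K) (hc₂ : ∀ n, c₂ n ∈ Set.Icc 0 K)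
    (hc₃ : ∀ n, c₃ n ∈ Set.Icc 0 K) (hs : Tendsto s₁ atTop atTop) (hr : ∀ n, s₂ n / s₁ n = r) :
    Tendsto (fun n => masterError (k n) (c₁ n) (c₂ n) (c₃ n) (s₁ n) (s₂ n)) atTop (𝓝 0) := by
  have hlim : Tendsto (fun n => K / (κ₀ * s₁ n) + 2 * √(|r| * K * K) / (κ₀ * √(s₁ n))) atTop
      (𝓝 (0 + 0)) :=
    (tendsto_const_nhds.div_atTop (hs.const_mul_atTop hκ₀)).add
      (tendsto_const_nhds.div_atTop ((Real.tendsto_sqrt_atTop.comp hs).const_mul_atTop hκ₀))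
  rw [add_zero] at hlim
  refine squeeze_zero' ?_ ?_ hlim
  · filter_upwards [hs.eventually_gt_atTop 0] with n hn
    exact masterError_nonneg (hκ₀.le.trans (hk n)) (hc₁ n).1 hn.le
  · filter_upwards [hs.eventually_gt_atTop 0] with n hn
    have hK : 0 ≤ K := (hc₁ n).1.trans (hc₁ n).2
    have h1 : r * c₂ n * c₃ n ≤ |r| * K * K := by
      have h2 := (hc₂ n).1
      have h3 := (hc₃ n).1
      have h4 := (hc₂ n).2
      have h5 := (hc₃ n).2
      have h6 := le_abs_self r
      gcongr
    have h2 := hk n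
    have h3 := (hc₁ n).2
    have h4 := Real.sqrt_pos.2 hn
    rw [masterError, hr n]
    gcongr

/-- If `C₃` vanished, the initial dual variable would coincide with two different points. -/
theorem constC3_pos {m : ℕ} [NeZero m] {h : (Fin m → ℝ) → ℝ} {σ fbar : ℝ} {B μ₁ : Fin m → ℝ}
    {T : ℕ} (hh : IsReferenceFunction h σ) (hσ : 0 < σ) (hμ₁ : 0 ≤ μ₁)
    (hd : DifferentiableAt ℝ h μ₁) (hf : 0 < fbar) (hT : 0 < T) (hB : ∀ j, 0 < B j) :
    0 < constC3 fbar h μ₁ B T := by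
  by_contra hle
  have hle := not_lt.1 hle
  have hw : 0 < fbar / minRho B T := div_pos hf (minRho_pos hT hB)
  have h1 : bregman h 0 μ₁ ≤ 0 := (le_max_left _ _).trans hle
  have h2 : bregman h (Pi.single 0 (fbar / minRho B T)) μ₁ ≤ 0 :=
    (le_ciSup (f := fun j => bregman h (Pi.single j (fbar / minRho B T)) μ₁)
      (Set.finite_range _).bddAbove 0).trans ((le_max_right _ _).trans hle)
  have h3 := eq_of_mul_sq_sum_abs_nonpos hσ ((hh.bregman_ge le_rfl hμ₁ hd).trans h1)
  have h4 := eq_of_mul_sq_sum_abs_nonpos hσ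
    ((hh.bregman_ge (Pi.single_nonneg.2 hw.le) hμ₁ hd).trans h2)
  have h5 := congrFun (h4.trans h3.symm) 0
  rw [Pi.single_eq_same, Pi.zero_apply] at h5
  exact hw.ne' h5

/-! ### The performance ratio -/

theorem mainTheorem3 {d m : ℕ} [NeZero m]
    -- the set of requests, with its bounds, and the request distribution
    (S : Set (Request d m)) [MeasurableSpace S] (P : Measure S) [IsProbabilityMeasure P]
    (fbar bbar : ℝ)
    (hf : ∀ q ∈ S, ∀ x, q.reward x ≤ fbar)
    (hb : ∀ q ∈ S, ∀ x j, q.consumption x j ≤ bbar)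
    -- the uncertainty window
    (τ₁ τ₂ : ℕ) (hτ₁ : 1 ≤ τ₁) (hτ : τ₁ ≤ τ₂)
    -- the algorithm and its input
    (A : DMDInput S)
    (hB : ∀ j, 0 < A.budget j) (hBb : ∀ j, 2 * bbar ≤ A.budget j)
    (σ : ℝ) (hσ : 0 < σ) (hh : IsReferenceFunction A.refFun σ)
    (hμ₁ : 0 ≤ A.initDual) (hμ₁' : DifferentiableAt ℝ A.refFun A.initDual)
    (hrule : A.RuleIsArgmax) (hmeas : A.RuleIsMeasurable)
    (htarget : IsTargetSequence A.budget τ₂ A.target)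
    (lbar : ℝ) (hlbar : ∀ t < τ₂, ∀ j, A.target t j ≤ lbar)
    -- bounds of the regret constants over the window
    (C₁' C₃' : ℝ)
    (hC₁ : ∀ T ∈ Finset.Icc τ₁ τ₂, constC1 fbar bbar A.budget T ≤ C₁')
    (hC₃ : ∀ T ∈ Finset.Icc τ₁ τ₂, constC3 fbar A.refFun A.initDual A.budget T ≤ C₃')
    (hη : A.stepSize = √(C₃' / (constC2 bbar lbar σ * (τ₂ : ℝ))))
    -- the hindsight optimum grows linearly over the window
    (κ : ℝ) (hκ : 0 < κ)
    (hopt : ∀ T ∈ Finset.Icc τ₁ τ₂,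
      κ * (T : ℝ) ≤ ∫ γ, hindsightOpt A.budget T γ ∂(Measure.pi fun _ : Fin T => P)) :
    (∀ T ∈ Finset.Icc τ₁ τ₂,
      targetRatio A.budget A.target T - masterError κ C₁' (constC2 bbar lbar σ) C₃' τ₁ τ₂ ≤
        A.performanceRatio T P) ∧
    -- the error vanishes as `τ₁ → ∞` with `τ₂ / τ₁` fixed, uniformly over bounded constants
    (∀ (r K κ₀ : ℝ), 0 < κ₀ → ∀ k c₁ c₂ c₃ s₁ s₂ : ℕ → ℝ,
      (∀ n, κ₀ ≤ k n) → (∀ n, c₁ n ∈ Set.Icc 0 K) → (∀ n, c₂ n ∈ Set.Icc 0 K) →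
      (∀ n, c₃ n ∈ Set.Icc 0 K) → Tendsto s₁ atTop atTop → (∀ n, s₂ n / s₁ n = r) →
      Tendsto (fun n => masterError (k n) (c₁ n) (c₂ n) (c₃ n) (s₁ n) (s₂ n)) atTop (𝓝 0)) := by
  have hτ₁pos : (0 : ℝ) < τ₁ := Nat.cast_pos.2 hτ₁
  have hq : Nonempty S := nonempty_of_isProbabilityMeasure P
  obtain ⟨q⟩ := hq
  have hb0 : 0 ≤ bbar := ((q : Request d m).consumption_nonneg _ 0).trans
    (hb q q.2 (q : Request d m).null 0)
  have hf0 : 0 ≤ fbar := ((q : Request d m).reward_nonneg _).trans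
    (hf q q.2 (q : Request d m).null)
  have hl0 : 0 ≤ lbar :=
    (htarget.1 0 (hτ₁.trans hτ) 0).trans (hlbar 0 (hτ₁.trans hτ) 0)
  refine ⟨fun T hT => ?_, fun r K κ₀ hκ₀ k c₁ c₂ c₃ s₁ s₂ hk hc₁ hc₂ hc₃ hs hr =>
    tendsto_masterError hκ₀ hk hc₁ hc₂ hc₃ hs hr⟩
  obtain ⟨hT₁, hT₂⟩ := Finset.mem_Icc.1 hT
  have hTpos : 0 < T := hτ₁.trans hT₁
  have hTpos' : (0 : ℝ) < T := Nat.cast_pos.2 hTpos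
  have hIκ := hopt T hT
  set I := ∫ γ, hindsightOpt A.budget T γ ∂(Measure.pi fun _ : Fin T => P) with hI
  have hIpos : 0 < I := (mul_pos hκ hTpos').trans_le hIκ
  have hint : Integrable (hindsightOpt A.budget T) (Measure.pi fun _ : Fin T => P) :=
    not_imp_comm.1 integral_undef hIpos.ne'
  have hfpos : 0 < fbar := by
    have h1 := hIpos.trans_le
      (DMDInput.integral_hindsightOpt_le_mul hf (fun j => (hB j).le) hint)
    exact pos_of_mul_pos_right h1 hTpos'.le
  have hC₁0 : 0 ≤ C₁' := by
    refine le_trans ?_ (hC₁ T hT)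
    have := minRho_pos hTpos hB
    unfold constC1
    positivity
  have hC₃pos : 0 < C₃' := (constC3_pos hh hσ hμ₁ hμ₁' hfpos hTpos hB).trans_le (hC₃ T hT)
  rw [DMDInput.performanceRatio]
  rcases (add_nonneg hb0 hl0).eq_or_lt with hzero | hpos
  · -- all targets vanish, and so does the guaranteed ratio; here `C₂ = 0` and the step size
    -- is `0`
    have h1 : targetRatio A.budget A.target T ≤ 0 := by
      refine mul_nonpos_of_nonneg_of_nonpos (by positivity)
        (Finset.sum_nonpos fun t ht => ?_)
      have h2 : A.target t 0 ≤ 0 :=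
        (hlbar t ((Finset.mem_range.1 ht).trans_le hT₂) 0).trans (by linarith)
      refine (min_le_left _ _).trans ((ciInf_le (Set.finite_range _).bddBelow 0).trans ?_)
      exact div_nonpos_of_nonpos_of_nonneg h2 (div_nonneg (hB 0).le hTpos'.le)
    have h2 := masterError_nonneg (C₂ := constC2 bbar lbar σ) (C₃ := C₃') (τ₂ := τ₂) hκ.le hC₁0
      hτ₁pos.le
    have h3 : 0 ≤ ∫ γ, A.totalReward T γ ∂(Measure.pi fun _ : Fin T => P) :=
      integral_nonneg fun γ => DMDInput.totalReward_nonneg γ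
    have h4 := div_nonneg h3 hIpos.le
    linarith
  · have hC₂pos : 0 < constC2 bbar lbar σ := by
      unfold constC2
      positivity
    have h1 := DMDInput.sub_le_integral_totalReward hf hb hf0 hb0 hTpos hT₂ hB hσ hh hμ₁ hμ₁'
      hrule hmeas htarget hlbar (hC₁ T hT) (hC₃ T hT) hC₂pos hC₃pos hη hint
    rw [masterError_eq hτ₁pos, le_div_iff₀ hIpos, sub_mul]
    refine le_trans (sub_le_sub_left ?_ _) h1
    rw [div_mul_eq_mul_div, le_div_iff₀ (by positivity)]
    refine mul_le_mul_of_nonneg_left ?_ (by positivity)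
    exact (mul_le_mul_of_nonneg_left (Nat.cast_le.2 hT₁) hκ.le).trans hIκ
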